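/- A one-dimensional cellular automaton consists of a finite nonempty set $S$ of states, a finite neighbourhood $N\subset\mathbb Z$ and a local rule $f:S^N\to S$; its global function $F:S^{\mathbb Z}\to S^{\mathbb Z}$ is $F(x)_i=f\big((x_{i+z})_{z\in N}\big)$. Let $d(x,y)=2^{-\min\{|n|\,:\,x_n\neq y_n\}}$ for $x\ne y$ in $S^{\mathbb Z}$, and $d(x,x)=0$. The automaton is sensitive to initial conditions if there is $\epsilon>0$ such that for every $x\in S^{\mathbb Z}$ and every $\delta>0$ there are $y\in S^{\mathbb Z}$ with $d(x,y)<\delta$ and $n\in\mathbb N$ with $d(F^n(x),F^n(y))>\epsilon$. Theorem 1. The problem of deciding, given (a standard finite description of) a one-dimensional cellular automaton, namely its number of states, its neighbourhood and the table of its local rule, whether it is sensitive to initial conditions is $\Pi^0_2$-complete. That is, the set of descriptions of sensitive automata is in $\Pi^0_2$ (it has the form $\{c : \forall x\,\exists y\,R(c,x,y)\}$ with $x,y\in\mathbb N$ and $R$ decidable), and every $\Pi^0_2$ set of natural numbers reduces to it by a computable many-one reduction. -/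

import Mathlib

/-- A one-dimensional cellular automaton with finite nonempty state set `S`: a finite neighbourhood
`N ⊆ ℤ` and a local transition function `S ^ N → S`. -/
structure CellularAutomaton (S : Type) [Finite S] [Nonempty S] where
  nbhd : Finset ℤ
  rule : (nbhd → S) → S

namespace CellularAutomaton

/-- The global function on configurations: the new state of cell `i` is the local function applied
to the pattern seen at the cells `i + z`, `z ∈ N`. -/
def globalMap {S : Type} [Finite S] [Nonempty S] (A : CellularAutomaton S) (x : ℤ → S) : ℤ → S :=
  fun i => A.rule (fun z => x (i + z.1))

open Classical in
/-- The metric `d(x, y) = 2 ^ (- min {|n| : x n ≠ y n})` on configurations (`0` if `x = y`). -/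
noncomputable def configDist {S : Type} (x y : ℤ → S) : ℝ :=
  if x = y then 0 else (2 : ℝ)⁻¹ ^ sInf {m : ℕ | ∃ n : ℤ, n.natAbs = m ∧ x n ≠ y n}

/-- Sensitivity to initial conditions. -/
def Sensitive {S : Type} [Finite S] [Nonempty S] (A : CellularAutomaton S) : Prop :=
  ∃ ε : ℝ, 0 < ε ∧ ∀ x : ℤ → S, ∀ δ : ℝ, 0 < δ →
    ∃ y : ℤ → S, configDist x y < δ ∧
      ∃ n : ℕ, ε < configDist (A.globalMap^[n] x) (A.globalMap^[n] y)

/-- A finite description of a one-dimensional cellular automaton: `(k, l, t)` stands for the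
automaton with state set `{0, …, k}`, neighbourhood listed by `l` and table of values `t`. -/
abbrev Code : Type := ℕ × List ℤ × List ℕ

/-- The automaton described by a code `(k, l, t)`. The value of the local function at a pattern is
the entry of `t` whose position is the number with base-`(k + 1)` digits (least significant first)
the states of the pattern in the order of `l`. Missing entries of `t` count as `0` and entries are
reduced modulo `k + 1`, so that every triple describes an automaton. -/
def ofCode (c : Code) : CellularAutomaton (Fin (c.1 + 1)) where
  nbhd := c.2.1.toFinset
  rule := fun p => Fin.ofNat (c.1 + 1) (c.2.2.getD
    (Nat.ofDigits (c.1 + 1) (c.2.1.attach.map fun z => (p ⟨z.1, List.mem_toFinset.2 z.2⟩ : ℕ))) 0)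

/-- Every one-dimensional cellular automaton has a code, up to renaming its states. -/
theorem exists_code {S : Type} [Finite S] [Nonempty S] (A : CellularAutomaton S) :
    ∃ (c : Code) (e : S ≃ Fin (c.1 + 1)), (ofCode c).nbhd = A.nbhd ∧
      ∀ x : ℤ → S, (ofCode c).globalMap (e ∘ x) = e ∘ A.globalMap x := by
  classical
  obtain ⟨m, ⟨e₀⟩⟩ := Finite.exists_equiv_fin S
  obtain ⟨k, rfl⟩ : ∃ k, m = k + 1 := by
    refine ⟨m - 1, ?_⟩
    have : m ≠ 0 := by
      rintro rfl
      exact (e₀ (Classical.arbitrary S)).elim0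
    omega
  let l := A.nbhd.toList
  let ix : (A.nbhd → S) → ℕ := fun p =>
    Nat.ofDigits (k + 1) (l.attach.map fun z => (e₀ (p ⟨z.1, Finset.mem_toList.1 z.2⟩) : ℕ))
  have hinj : Function.Injective ix := by
    intro p q h
    rcases Nat.eq_zero_or_pos k with rfl | hk
    · funext z
      exact e₀.injective (Fin.ext (by omega))
    have h' := Nat.ofDigits_inj_of_len_eq (b := k + 1) (by omega) (by simp)
      (by simp only [List.mem_map]; rintro _ ⟨z, -, rfl⟩; exact Fin.is_lt _)
      (by simp only [List.mem_map]; rintro _ ⟨z, -, rfl⟩; exact Fin.is_lt _) h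
    rw [List.map_inj_left] at h'
    funext z
    have := h' ⟨z.1, Finset.mem_toList.2 z.2⟩ (List.mem_attach _ _)
    exact e₀.injective (Fin.ext this)
  have hlt : ∀ p, ix p < (k + 1) ^ l.length + 1 := by
    intro p
    rcases Nat.eq_zero_or_pos k with rfl | hk
    · have : ix p = 0 := by
        refine Nat.eq_zero_of_le_zero ?_
        have hz : ∀ L : List ℕ, (∀ a ∈ L, a = 0) → Nat.ofDigits (0 + 1) L ≤ 0 := by
          intro L hL
          induction L with
          | nil => simp
          | cons a L ih =>
            have ha : a = 0 := hL a (by simp)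
            have := ih (fun b hb => hL b (by simp [hb]))
            simp only [Nat.ofDigits_cons, ha]
            simpa using this
        apply hz
        simp only [List.mem_map]
        rintro _ ⟨z, -, rfl⟩
        omega
      rw [this]
      exact Nat.succ_pos _
    · have := Nat.ofDigits_lt_base_pow_length (b := k + 1)
        (l := l.attach.map fun z => (e₀ (p ⟨z.1, Finset.mem_toList.1 z.2⟩) : ℕ)) (by omega)
        (by simp only [List.mem_map]; rintro _ ⟨z, -, rfl⟩; exact Fin.is_lt _)
      simp only [List.length_map, List.length_attach] at this
      exact Nat.lt_succ_of_lt this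
  let t : List ℕ := (List.range ((k + 1) ^ l.length + 1)).map fun i =>
    (e₀ (A.rule (Function.invFun ix i)) : ℕ)
  refine ⟨(k, l, t), e₀, by simp [ofCode, l], ?_⟩
  intro x
  funext i
  let p : A.nbhd → S := fun z => x (i + z.1)
  have ht : t.getD (ix p) 0 = (e₀ (A.rule p) : ℕ) := by
    simp [t, List.getD, List.getElem?_range (hlt p), Function.leftInverse_invFun hinj p]
  change Fin.ofNat (k + 1) (t.getD (ix p) 0) = e₀ (A.rule p)
  rw [ht]
  exact Fin.ext (Nat.mod_eq_of_lt (Fin.is_lt _))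

end CellularAutomaton

/-- The arithmetical class `Π⁰₂`: predicates of the form `∀ x, ∃ y, R a x y` with `R` decidable. -/
def IsPi02 {α : Type} [Primcodable α] (p : α → Prop) : Prop :=
  ∃ R : α × ℕ × ℕ → Prop, ComputablePred R ∧ ∀ a, p a ↔ ∀ x, ∃ y, R (a, x, y)

/-- `Π⁰₂`-completeness: membership in `Π⁰₂`, and every `Π⁰₂` set of natural numbers reduces to the
problem by a computable many-one reduction. -/
def Pi02Complete {α : Type} [Primcodable α] (p : α → Prop) : Prop :=
  IsPi02 p ∧ ∀ q : ℕ → Prop, IsPi02 q → ManyOneReducible q p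

/-!
# Sensitivity of one-dimensional cellular automata is `Π⁰₂`-complete

**Membership.** Let `r` bound the neighbourhood. An automaton is sensitive if and only if no word is
`r`-blocking (`CellularAutomaton.sensitive_iff_noBlockingWord`): the periodic repetition of a
blocking word is an equicontinuity point, because the copies of the word cut the cells between them
off from the outside; and if there is no blocking word, then the cells far away from the origin can
always influence the cells `-r, …, r`. That the word `u` is not blocking is witnessed by two finite
extensions of `u` and a time at which their evolutions differ near the origin, and the evolution of
finite words is primitive recursive (`CellularAutomaton.Code.primrecPred_separates`).

**Hardness.** Let `q a ↔ ∀ x, ∃ y, R (a, x, y)` with `R` decidable. A fixed Turing machine with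
finitely many states and symbols halts on `a` and `x` if and only if `∃ y, R (a, x, y)`
(`Turing.exists_finite_machine`). For every `a` there is an automaton that simulates it:

* An *eraser* runs left over everything but walls, and carries a payload bit.
* A *wall* reached by an eraser stores the payload and starts the machine on its right: a front runs
  off to the right at speed one and writes the input, namely `a`, which is known to the local rule,
  and the length `x` of a block of marked cells, in unary. The head of the machine works behind the
  front, where the two-sided tape is folded into the cells right of the wall.
* If the machine halts, then a *killer* runs left and turns the wall into an eraser, which carries
  the stored payload on.

If the machine does not halt on `a` and `x`, then a row of walls followed by a block of `x` marked
cells is a blocking word (`CellState.iterate_eq_wall`): whenever something disturbs the computation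
from the right, an eraser comes back and the computation is restarted, and otherwise it runs
forever, so that the wall always stays (`CellState.Persists.global`). If the machine halts on `a`
and every `x`, then an eraser placed right of a word, with blank cells behind it, passes through the
whole word: each wall it meets starts a computation that nothing disturbs, which halts and turns
the wall into an eraser. Thus the payload reaches the origin (`CellState.exists_iterate_ne`), and no
word is blocking. The table of the automaton is primitive recursive in `a`, because only the range
of a counter depends on `a` (`CellState.primrec_code`).
-/

/-! ### Sensitivity and blocking words -/

namespace CellularAutomaton

section Metric

variable {S : Type}

lemma le_configDist_of_ne {x y : ℤ → S} {i : ℤ} {r : ℕ} (hi : i.natAbs ≤ r) (h : x i ≠ y i) :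
    (2 : ℝ)⁻¹ ^ r ≤ configDist x y := by
  have hne : x ≠ y := fun e => h (by rw [e])
  rw [configDist, if_neg hne]
  refine pow_le_pow_of_le_one (by norm_num) (by norm_num) ?_
  exact (Nat.sInf_le (s := {m : ℕ | ∃ n : ℤ, n.natAbs = m ∧ x n ≠ y n}) ⟨i, rfl, h⟩).trans hi

lemma configDist_le_of_agree {x y : ℤ → S} {n : ℕ} (h : ∀ i : ℤ, i.natAbs ≤ n → x i = y i) :
    configDist x y ≤ (2 : ℝ)⁻¹ ^ n := by
  by_cases hne : x = y
  · rw [configDist, if_pos hne]; positivity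
  · rw [configDist, if_neg hne]
    refine pow_le_pow_of_le_one (by norm_num) (by norm_num) ?_
    obtain ⟨i, hi⟩ := Function.ne_iff.1 hne
    obtain ⟨j, hj, hj'⟩ :=
      Nat.sInf_mem (s := {m : ℕ | ∃ n : ℤ, n.natAbs = m ∧ x n ≠ y n}) ⟨_, i, rfl, hi⟩
    rw [← hj]
    by_contra hlt
    exact hj' (h j (by omega))

end Metric

section Blocking

variable {S : Type} [Finite S] [Nonempty S]

/-- Every word `u`, written on the cells `-n, …, n`, has two extensions whose orbits differ at some
time in one of the cells `-r, …, r`: in other words, no word is `r`-blocking. -/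
def NoBlockingWord (A : CellularAutomaton S) (r : ℕ) : Prop :=
  ∀ (n : ℕ) (u : ℤ → S), ∃ x y : ℤ → S, (∀ i : ℤ, i.natAbs ≤ n → x i = u i) ∧
    (∀ i : ℤ, i.natAbs ≤ n → y i = u i) ∧
    ∃ (t : ℕ) (i : ℤ), i.natAbs ≤ r ∧ A.globalMap^[t] x i ≠ A.globalMap^[t] y i

lemma globalMap_shift (A : CellularAutomaton S) (x : ℤ → S) (k : ℤ) (t : ℕ) :
    A.globalMap^[t] (fun i => x (i + k)) = fun i => A.globalMap^[t] x (i + k) := by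
  induction t with
  | zero => rfl
  | succ t ih =>
    rw [Function.iterate_succ_apply', ih, Function.iterate_succ_apply']
    funext i
    simp only [globalMap, add_right_comm]

/-- The periodic repetition of a blocking word is an equicontinuity point: the copies of the word
at `± (M + 1) * (2 * n + 1)` cut the cells between them off from the outside. -/
lemma not_sensitive_of_blocking (A : CellularAutomaton S) (r : ℕ)
    (hr : ∀ z ∈ A.nbhd, z.natAbs ≤ r) (n : ℕ) (u : ℤ → S)
    (hu : ∀ x y : ℤ → S, (∀ i : ℤ, i.natAbs ≤ n → x i = u i) →
      (∀ i : ℤ, i.natAbs ≤ n → y i = u i) →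
      ∀ (t : ℕ) (i : ℤ), i.natAbs ≤ r → A.globalMap^[t] x i = A.globalMap^[t] y i) :
    ¬ A.Sensitive := by
  rintro ⟨ε, hε, hA⟩
  obtain ⟨M, hM⟩ := exists_pow_lt_of_lt_one hε (show (2 : ℝ)⁻¹ < 1 by norm_num)
  set P : ℤ := 2 * n + 1 with hP
  let x : ℤ → S := fun i => u ((i + n) % P - n)
  have hx : ∀ k i : ℤ, i.natAbs ≤ n → x (i + k * P) = u i := by
    intro k i hi
    have h1 : (i + k * P + n) % P = i + n := by
      rw [show i + k * P + n = i + n + k * P by ring, Int.add_mul_emod_self_right,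
        Int.emod_eq_of_lt (by omega) (by omega)]
    simp only [x, h1, add_sub_cancel_right]
  set Q : ℤ := (M + 1) * P with hQ
  have hQM : (M : ℤ) + 1 ≤ Q := by nlinarith
  obtain ⟨y, hxy, t, ht⟩ := hA x ((2 : ℝ)⁻¹ ^ (Q + n).toNat) (by positivity)
  have hag : ∀ i : ℤ, i.natAbs ≤ (Q + n).toNat → x i = y i := fun i hi => by
    by_contra hne
    exact absurd (le_configDist_of_ne hi hne) (not_le.2 hxy)
  have hblock : ∀ (t : ℕ) (k : ℤ), k = M + 1 ∨ k = -(M + 1) → ∀ i : ℤ, i.natAbs ≤ r →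
      A.globalMap^[t] x (i + k * P) = A.globalMap^[t] y (i + k * P) := by
    intro t k hk i hi
    have hkQ : k * P = Q ∨ k * P = -Q := by
      rcases hk with rfl | rfl
      · left; rfl
      · right; rw [hQ]; ring
    have := hu (fun i => x (i + k * P)) (fun i => y (i + k * P)) (fun i hi => hx k i hi)
      (fun i hi => by rw [← hag _ (by omega)]; exact hx k i hi) t i hi
    rwa [globalMap_shift, globalMap_shift] at this
  have hin : ∀ (t : ℕ) (i : ℤ), -Q ≤ i → i ≤ Q →
      A.globalMap^[t] x i = A.globalMap^[t] y i := by
    intro t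
    induction t with
    | zero => intro i h1 h2; exact hag i (by omega)
    | succ t ih =>
      intro i h1 h2
      by_cases hR : Q - r ≤ i
      · have := hblock (t + 1) (M + 1) (Or.inl rfl) (i - Q) (by omega)
        rwa [← hQ, sub_add_cancel] at this
      by_cases hL : i ≤ -Q + r
      · have := hblock (t + 1) (-(M + 1)) (Or.inr rfl) (i + Q) (by omega)
        rwa [show i + Q + -(M + 1) * P = i by rw [hQ]; ring] at this
      rw [Function.iterate_succ_apply', Function.iterate_succ_apply']
      simp only [globalMap]
      congr 1
      funext z
      have := hr z.1 z.2
      exact ih _ (by omega) (by omega)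
  have := configDist_le_of_agree (n := M) (fun i hi => hin t i (by omega) (by omega))
  linarith

theorem sensitive_iff_noBlockingWord (A : CellularAutomaton S) (r : ℕ)
    (hr : ∀ z ∈ A.nbhd, z.natAbs ≤ r) : A.Sensitive ↔ A.NoBlockingWord r := by
  constructor
  · intro hA n u
    by_contra hcon
    refine not_sensitive_of_blocking A r hr n u (fun x y hx hy t i hi => ?_) hA
    by_contra hne
    exact hcon ⟨x, y, hx, hy, t, i, hi, hne⟩
  · intro hA
    refine ⟨(2 : ℝ)⁻¹ ^ (r + 1), by positivity, fun x δ hδ => ?_⟩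
    obtain ⟨n, hn⟩ := exists_pow_lt_of_lt_one hδ (show (2 : ℝ)⁻¹ < 1 by norm_num)
    have hlt : (2 : ℝ)⁻¹ ^ (r + 1) < (2 : ℝ)⁻¹ ^ r :=
      pow_lt_pow_right_of_lt_one₀ (by norm_num) (by norm_num) (Nat.lt_succ_self r)
    obtain ⟨y, z, hy, hz, t, i, hi, hne⟩ := hA n x
    by_cases hxy : A.globalMap^[t] x i = A.globalMap^[t] y i
    · exact ⟨z, (configDist_le_of_agree fun i hi => (hz i hi).symm).trans_lt hn, t,
        hlt.trans_le (le_configDist_of_ne hi (hxy ▸ hne))⟩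
    · exact ⟨y, (configDist_le_of_agree fun i hi => (hy i hi).symm).trans_lt hn, t,
        hlt.trans_le (le_configDist_of_ne hi hxy)⟩

end Blocking

end CellularAutomaton

/-! ### A finite Turing machine for a semidecidable relation -/

namespace Turing

namespace ToPartrec.Code

/-- The loop body of `countZeros`: on a list `n :: h :: t` it returns `1 :: (n + 1) :: t` (go on)
if `h = 0`, and `0 :: n :: t` (stop) otherwise. -/
def countZerosStep : Code :=
  comp (case (cons (comp succ zero') (cons succ tail)) (comp zero' tail))
    (cons tail (cons head (comp tail tail)))

/-- Adds to the first entry of a list the number of zeros that follow it, up to the first nonzero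
entry, which is removed together with these zeros. -/
def countZeros : Code := fix countZerosStep

lemma countZerosStep_zero (n : ℕ) (t : List ℕ) :
    countZerosStep.eval (n :: 0 :: t) = pure (1 :: (n + 1) :: t) := by
  simp [countZerosStep]

lemma countZerosStep_one (n : ℕ) (t : List ℕ) :
    countZerosStep.eval (n :: 1 :: t) = pure (0 :: n :: t) := by
  simp [countZerosStep]

lemma countZeros_eval (k n : ℕ) (t : List ℕ) :
    countZeros.eval (n :: (List.replicate k 0 ++ 1 :: t)) = pure ((n + k) :: t) := by
  refine Part.eq_some_iff.2 ?_
  induction k generalizing n with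
  | zero =>
    rw [countZeros, fix_eval]
    refine PFun.mem_fix_iff.2 (Or.inl ?_)
    simp [countZerosStep_one]
  | succ k ih =>
    rw [countZeros, fix_eval]
    refine PFun.mem_fix_iff.2 (Or.inr ⟨(n + 1) :: (List.replicate k 0 ++ 1 :: t), ?_, ?_⟩)
    · simp [List.replicate_succ, countZerosStep_zero]
    · have := ih (n + 1)
      rw [countZeros, fix_eval] at this
      rwa [show n + (k + 1) = n + 1 + k by ring]

/-- Decodes a pair of numbers written in unary. -/
def unaryPair : Code :=
  cons (comp countZeros zero') (comp countZeros (comp zero' (comp tail (comp countZeros zero'))))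

lemma comp_eval_of_eq_some {f g : Code} {v w : List ℕ} (h : g.eval v = Part.some w) :
    (comp f g).eval v = f.eval w := by
  refine (congrFun (comp_eval f g) v).trans ?_
  change Part.bind (g.eval v) f.eval = _
  rw [h]
  exact Part.bind_some _ _

lemma cons_eval_of_eq_some {f g : Code} {v w w' : List ℕ} (hf : f.eval v = Part.some w)
    (hg : g.eval v = Part.some w') : (cons f g).eval v = Part.some (w.headI :: w') := by
  refine (congrFun (cons_eval f g) v).trans ?_
  change Part.bind (f.eval v)
    (fun n => Part.bind (g.eval v) fun ns => Part.some (n.headI :: ns)) = _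
  rw [hf, hg]
  exact (Part.bind_some _ _).trans (Part.bind_some _ _)

lemma unaryPair_eval (x a : ℕ) :
    unaryPair.eval (List.replicate x 0 ++ 1 :: (List.replicate a 0 ++ [1])) =
      Part.some [x, a] := by
  have h1 : (comp countZeros zero').eval (List.replicate x 0 ++ 1 :: (List.replicate a 0 ++ [1])) =
      Part.some (x :: (List.replicate a 0 ++ [1])) := by
    rw [comp_eval_of_eq_some (congrFun zero'_eval _), countZeros_eval, zero_add, Part.pure_eq_some]
  refine cons_eval_of_eq_some h1 ?_
  rw [comp_eval_of_eq_some (w := 0 :: (List.replicate a 0 ++ [1])), countZeros_eval, zero_add,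
    Part.pure_eq_some]
  rw [comp_eval_of_eq_some (w := List.replicate a 0 ++ [1]), zero'_eval]
  · rfl
  · rw [comp_eval_of_eq_some h1, tail_eval]
    rfl

end ToPartrec.Code

open ToPartrec in
/-- Unbounded search for a witness of a decidable relation is carried out by a sequential code. -/
lemma exists_code_search {R : ℕ × ℕ × ℕ → Prop} (hR : ComputablePred R) :
    ∃ c : Code, ∀ a x : ℕ,
      (c.eval (List.replicate x 0 ++ 1 :: (List.replicate a 0 ++ [1]))).Dom ↔
        ∃ y, R (a, x, y) := by
  obtain ⟨hdec, hcomp⟩ := hR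
  let f : List.Vector ℕ 2 →. ℕ := fun v =>
    Nat.rfind fun y => Part.some (decide (R (v.tail.head, v.head, y)))
  have hf : Partrec f := by
    refine Partrec.rfind (p := fun (v : List.Vector ℕ 2) (y : ℕ) =>
      Part.some (decide (R (v.tail.head, v.head, y)))) ?_
    have h1 : Computable fun p : List.Vector ℕ 2 × ℕ =>
        ((p.1.tail.head, p.1.head, p.2) : ℕ × ℕ × ℕ) :=
      Primrec.to_comp (Primrec.pair
        (Primrec.vector_head.comp (Primrec.vector_tail.comp Primrec.fst)) (Primrec.pair (Primrec.vector_head.comp Primrec.fst) Primrec.snd))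
    exact (hcomp.comp h1).partrec
  obtain ⟨c, hc⟩ := Code.exists_code (Nat.Partrec'.of_part hf)
  refine ⟨c.comp Code.unaryPair, fun a x => ?_⟩
  have h2 := hc (x ::ᵥ a ::ᵥ List.Vector.nil)
  rw [Code.comp_eval_of_eq_some (Code.unaryPair_eval x a)]
  refine (iff_of_eq (congrArg Part.Dom h2)).trans ?_
  change (Nat.rfind fun y => Part.some (decide (R (a, x, y)))).Dom ↔ _
  refine Nat.rfind_dom.trans ?_
  constructor
  · rintro ⟨y, hy, -⟩
    exact ⟨y, of_decide_eq_true (Part.mem_some_iff.1 hy).symm⟩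
  · rintro ⟨y, hy⟩
    exact ⟨y, Part.mem_some_iff.2 (decide_eq_true hy).symm, fun _ => trivial⟩

instance : Fintype PartrecToTM2.K' :=
  ⟨{.main, .rev, .aux, .stack}, fun x => by cases x <;> simp⟩

/-- The restriction of a machine to a set of states that supports it. -/
def TM0.Machine.restrict {Γ Λ : Type} [Inhabited Γ] [Inhabited Λ] (M : TM0.Machine Γ Λ) {S : Set Λ}
    (ss : TM0.Supports M S) : @TM0.Machine Γ S ⟨⟨default, ss.1⟩⟩ :=
  fun q a => match h : M q.1 a with
    | none => none
    | some (q', s) => some (⟨q', ss.2 h q.2⟩, s)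

lemma TM0.Machine.restrict_eval_dom {Γ Λ : Type} [Inhabited Γ] [Inhabited Λ]
    (M : TM0.Machine Γ Λ) {S : Set Λ} (ss : TM0.Supports M S) (l : List Γ) :
    (@TM0.eval Γ S ⟨⟨default, ss.1⟩⟩ _ (M.restrict ss) l).Dom ↔ (TM0.eval M l).Dom := by
  let _ : Inhabited S := ⟨⟨default, ss.1⟩⟩
  symm
  refine StateTransition.tr_eval_dom (f₁ := TM0.step (M.restrict ss)) (f₂ := TM0.step M)
    (tr := fun c d => (⟨c.q.1, c.Tape⟩ : TM0.Cfg Γ Λ) = d) ?_ rfl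
  rw [StateTransition.fun_respects]
  rintro ⟨q, T⟩
  have key : (TM0.step (M.restrict ss) ⟨q, T⟩).map (fun c => (⟨c.q.1, c.Tape⟩ : TM0.Cfg Γ Λ)) =
      TM0.step M ⟨q.1, T⟩ := by
    simp only [TM0.step, TM0.Machine.restrict]
    split <;> rename_i h <;> simp [h]
  cases h : TM0.step (M.restrict ss) ⟨q, T⟩ with
  | none => rw [h] at key; exact key.symm
  | some c =>
    rw [h] at key
    exact Relation.TransGen.single key.symm

open PartrecToTM2 in
lemma trList_replicate_zero (n : ℕ) (l : List ℕ) :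
    trList (List.replicate n 0 ++ l) = List.replicate n Γ'.cons ++ trList l := by
  induction n with
  | zero => rfl
  | succ n ih => simp [List.replicate_succ, ih]

open PartrecToTM2 in
lemma trNat_one : trNat 1 = [Γ'.bit1] := by
  simp [trNat, trNum, trPosNum]

open PartrecToTM2 in
/-- A semidecidable relation `∃ y, R (a, x, y)` is the halting relation of a Turing machine with
finitely many states and symbols, started on `a` and `x` in unary. The input is arranged so that
the unary digits of `x` come last, as the cells of a wall's marks do. -/
theorem exists_finite_machine {R : ℕ × ℕ × ℕ → Prop} (hR : ComputablePred R) :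
    ∃ (Γ Q : Type) (_ : Finite Γ) (_ : Finite Q) (_ : Inhabited Γ) (_ : Inhabited Q)
      (M : TM0.Machine Γ Q) (s₀ s₁ s₂ : Γ), ∀ a x : ℕ,
      (TM0.eval M
        (s₀ :: s₁ :: (List.replicate (a + 1) s₂ ++ s₁ :: List.replicate x s₂))).Dom ↔
        ∃ y, R (a, x, y) := by
  obtain ⟨c, hc⟩ := exists_code_search hR
  let _ : Inhabited Λ' := ⟨trNormal c Cont'.halt⟩
  have s2 : TM2.Supports PartrecToTM2.tr (codeSupp c Cont'.halt) :=
    PartrecToTM2.tr_supports c Cont'.halt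
  have s1 := TM2to1.tr_supports PartrecToTM2.tr s2
  have s0 := TM1to0.tr_supports (TM2to1.tr PartrecToTM2.tr) s1
  let sym : PartrecToTM2.Γ' → TM2to1.Γ' K' fun _ => PartrecToTM2.Γ' := fun s =>
    (false, Function.update (fun _ => none) K'.main (some s))
  refine ⟨TM2to1.Γ' K' fun _ => PartrecToTM2.Γ', _, inferInstance, ?_, inferInstance,
    ⟨⟨default, s0.1⟩⟩, (TM1to0.tr (TM2to1.tr PartrecToTM2.tr)).restrict s0,
    (true, (sym .cons).2), sym .bit1, sym .cons, fun a x => ?_⟩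
  · exact Finset.finite_toSet _
  rw [TM0.Machine.restrict_eval_dom, TM1to0.tr_eval, ← hc]
  set v := List.replicate x 0 ++ 1 :: (List.replicate a 0 ++ [1]) with hv
  have htr : TM2to1.trInit K'.main (trList v) = ((true, (sym .cons).2) : TM2to1.Γ' K' _) ::
      sym .bit1 :: (List.replicate (a + 1) (sym .cons) ++
        sym .bit1 :: List.replicate x (sym .cons)) := by
    have hrev : (trList v).reverse = PartrecToTM2.Γ'.cons :: .bit1 ::
        (List.replicate (a + 1) .cons ++ .bit1 :: List.replicate x .cons) := by
      simp [hv, trList_replicate_zero, trNat_one, List.replicate_succ']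
    have hmap : (trList v).reverse.map sym = sym .cons :: sym .bit1 ::
        (List.replicate (a + 1) (sym .cons) ++ sym .bit1 :: List.replicate x (sym .cons)) := by
      rw [hrev, List.map_cons, List.map_cons, List.map_append, List.map_replicate, List.map_cons,
        List.map_replicate]
    change (true, ((trList v).reverse.map sym).headI.2) :: ((trList v).reverse.map sym).tail = _
    rw [hmap]
    rfl
  have h1 := TM2to1.tr_eval_dom (M := PartrecToTM2.tr) K'.main (trList v)
  rw [htr] at h1
  refine h1.trans ?_
  have h2 := PartrecToTM2.tr_eval c v
  have h3 : (TM2.init K'.main (trList v) : TM2.Cfg (fun _ : K' => PartrecToTM2.Γ') Λ' (Option _)) =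
      PartrecToTM2.init c v := by
    simp only [TM2.init, PartrecToTM2.init]
    congr 1
    funext k
    cases k <;> rfl
  change (StateTransition.eval (TM2.step PartrecToTM2.tr) (TM2.init K'.main (trList v))).Dom ↔ _
  rw [h3, h2]
  rfl

end Turing

/-! ### Folding a two-sided tape -/

namespace Turing

/-- A configuration of a machine on a two-sided tape folded at the origin: cell `i` of the folded
tape holds the symbols of the tape cells `i` (side `true`) and `-(i + 1)` (side `false`). -/
structure FoldedCfg (Γ Q : Type) where
  state : Q
  side : Bool
  pos : ℕ
  tape : Bool → ℕ → Γ

/-- On side `b` of the folded tape, does a move in direction `d` lead away from the origin? -/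
def outward (d : Dir) (b : Bool) : Bool := (d == Dir.right) == b

namespace FoldedCfg

variable {Γ Q : Type}

/-- One step of the folded machine. -/
def step [Inhabited Q] (M : TM0.Machine Γ Q) (c : FoldedCfg Γ Q) : Option (FoldedCfg Γ Q) :=
  match M c.state (c.tape c.side c.pos) with
  | none => none
  | some (q, TM0.Stmt.write g) =>
    some ⟨q, c.side, c.pos, Function.update c.tape c.side (Function.update (c.tape c.side) c.pos g)⟩
  | some (q, TM0.Stmt.move d) =>
    if outward d c.side then some ⟨q, c.side, c.pos + 1, c.tape⟩
    else if c.pos = 0 then some ⟨q, !c.side, 0, c.tape⟩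
    else some ⟨q, c.side, c.pos - 1, c.tape⟩

/-- The position on the two-sided tape of a cell of the folded tape. -/
def coord (b : Bool) (i : ℕ) : ℤ := if b then i else -(i + 1)

lemma coord_injective {b b' : Bool} {i i' : ℕ} (h : coord b i = coord b' i') : b = b' ∧ i = i' := by
  cases b <;> cases b' <;> simp [coord] at h ⊢ <;> omega

/-- The folded configuration `c` represents the configuration `d` of the two-sided machine. -/
def Represents [Inhabited Γ] (d : TM0.Cfg Γ Q) (c : FoldedCfg Γ Q) : Prop :=
  c.state = d.q ∧ ∀ b i, c.tape b i = d.Tape.nth (coord b i - coord c.side c.pos)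

lemma step_represents [Inhabited Γ] [Inhabited Q] (M : TM0.Machine Γ Q) {d : TM0.Cfg Γ Q}
    {c : FoldedCfg Γ Q} (h : Represents d c) :
    match TM0.step M d with
    | none => step M c = none
    | some d' => ∃ c', step M c = some c' ∧ Represents d' c' := by
  obtain ⟨q, T⟩ := d
  obtain ⟨q', b, i, t⟩ := c
  obtain ⟨rfl, ht⟩ := h
  simp only at ht
  have hhead : t b i = T.1 := by rw [ht, sub_self]; rfl
  simp only [TM0.step, step, hhead]
  rcases M q' T.1 with _ | ⟨q'', d | g⟩
  · simp
  · have key : ∃ b' i', (if outward d b = true then some (⟨q'', b, i + 1, t⟩ : FoldedCfg Γ Q)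
        else if i = 0 then some ⟨q'', !b, 0, t⟩ else some ⟨q'', b, i - 1, t⟩) =
        some ⟨q'', b', i', t⟩ ∧ coord b' i' = coord b i + (if d = Dir.right then 1 else -1) := by
      cases d <;> cases b <;> cases i <;> refine ⟨_, _, rfl, ?_⟩ <;> (simp [coord]; try omega)
    obtain ⟨b', i', h1, h2⟩ := key
    refine ⟨_, h1, rfl, fun b₁ i₁ => ?_⟩
    simp only [h2, ht]
    cases d
    · simp only [Tape.move_left_nth]
      congr 1
      simp
      ring
    · simp only [Tape.move_right_nth]
      congr 1
      simp
      ring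
  · refine ⟨_, rfl, rfl, fun b₁ i₁ => ?_⟩
    simp only [Tape.write_nth]
    by_cases hb : b₁ = b ∧ i₁ = i
    · obtain ⟨rfl, rfl⟩ := hb
      simp
    · have hne : coord b₁ i₁ - coord b i ≠ 0 := fun h0 =>
        hb (coord_injective (sub_eq_zero.1 h0))
      rw [if_neg hne, ← ht]
      by_cases hb' : b₁ = b
      · subst hb'
        have : i₁ ≠ i := fun h => hb ⟨rfl, h⟩
        simp [this]
      · simp [hb']

/-- The initial configuration, with the input on the side `true`. -/
def init [Inhabited Γ] [Inhabited Q] (w : ℕ → Γ) : FoldedCfg Γ Q :=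
  ⟨default, true, 0, fun b i => if b then w i else default⟩

/-- The configuration after `n` steps; it no longer changes once the machine has halted. -/
def run [Inhabited Γ] [Inhabited Q] (M : TM0.Machine Γ Q) (w : ℕ → Γ) (n : ℕ) : FoldedCfg Γ Q :=
  (fun c => (step M c).getD c)^[n] (init w)

lemma step_pos_le [Inhabited Q] (M : TM0.Machine Γ Q) {c c' : FoldedCfg Γ Q}
    (h : step M c = some c') : c'.pos ≤ c.pos + 1 := by
  unfold step at h
  split at h
  · simp at h
  · simp only [Option.some.injEq] at h; subst h; simp
  · split_ifs at h <;> simp only [Option.some.injEq] at h <;> subst h <;> simp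
    omega

lemma step_tape [Inhabited Q] (M : TM0.Machine Γ Q) {c c' : FoldedCfg Γ Q}
    (h : step M c = some c') {b : Bool} {i : ℕ} (hi : c.pos ≠ i) : c'.tape b i = c.tape b i := by
  unfold step at h
  split at h
  · simp at h
  · simp only [Option.some.injEq] at h
    subst h
    by_cases hb : b = c.side
    · subst hb; simp [hi.symm]
    · simp [hb]
  · split_ifs at h <;> simp only [Option.some.injEq] at h <;> subst h <;> rfl

section run

variable [Inhabited Γ] [Inhabited Q] (M : TM0.Machine Γ Q) (w : ℕ → Γ)

lemma run_succ (n : ℕ) : run M w (n + 1) = (step M (run M w n)).getD (run M w n) :=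
  Function.iterate_succ_apply' _ _ _

lemma run_succ_eq {n : ℕ} {c : FoldedCfg Γ Q} (h : step M (run M w n) = some c) :
    run M w (n + 1) = c := by rw [run_succ, h]; rfl

lemma run_pos_le (n : ℕ) : (run M w n).pos ≤ n := by
  induction n with
  | zero => exact le_rfl
  | succ n ih =>
    rw [run_succ]
    cases h : step M (run M w n) with
    | none => simp; omega
    | some c => have := step_pos_le M h; simp; omega

/-- Cell `i` keeps its initial content for the first `i` steps. -/
lemma run_tape {n i : ℕ} (b : Bool) (hi : n ≤ i) :
    (run M w n).tape b i = if b then w i else default := by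
  induction n with
  | zero => rfl
  | succ n ih =>
    rw [← ih (by omega), run_succ]
    cases h : step M (run M w n) with
    | none => rfl
    | some c => exact step_tape M h (by have := run_pos_le M w n; omega)

lemma reaches_run (n : ℕ) : StateTransition.Reaches (step M) (init w) (run M w n) := by
  induction n with
  | zero => exact Relation.ReflTransGen.refl
  | succ n ih =>
    rw [run_succ]
    cases h : step M (run M w n) with
    | none => exact ih
    | some c => exact ih.tail h

lemma exists_run_of_reaches {c : FoldedCfg Γ Q} (h : StateTransition.Reaches (step M) (init w) c) :
    ∃ n, run M w n = c := by
  induction h with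
  | refl => exact ⟨0, rfl⟩
  | tail _ h ih =>
    obtain ⟨n, rfl⟩ := ih
    exact ⟨n + 1, run_succ_eq M w h⟩

/-- The folded machine halts exactly when the two-sided machine does. -/
lemma exists_step_run_eq_none_iff (l : List Γ) (hl : ∀ i, l.getI i = w i) :
    (∃ n, step M (run M w n) = none) ↔ (TM0.eval M l).Dom := by
  have hrep : Represents (TM0.init l : TM0.Cfg Γ Q) (init w) := by
    refine ⟨rfl, fun b i => ?_⟩
    cases b
    · change default = _
      have : coord false i - coord true 0 = Int.negSucc i := by
        simp [coord, Int.negSucc_eq]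
      simp only [init, TM0.init, Tape.mk₁, Tape.mk₂, this]
      change _ = (ListBlank.mk []).nth i
      rw [ListBlank.nth_mk]
      simp
    · change w i = _
      simp only [init, TM0.init, coord, Tape.mk₁, Tape.mk₂]
      simp [Tape.mk'_nth_nat, ListBlank.nth_mk, hl]
  have hresp : StateTransition.Respects (TM0.step M) (step M) Represents := by
    intro d c hdc
    have := step_represents M hdc
    cases h : TM0.step M d with
    | none => rw [h] at this; exact this
    | some d' =>
      rw [h] at this
      obtain ⟨c', h1, h2⟩ := this
      exact ⟨c', h2, Relation.TransGen.single h1⟩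
  have h1 := StateTransition.tr_eval_dom hresp hrep
  change _ ↔ (StateTransition.eval (TM0.step M) (TM0.init l)).Dom
  rw [← h1, Part.dom_iff_mem]
  simp only [StateTransition.mem_eval]
  constructor
  · rintro ⟨n, hn⟩
    exact ⟨_, reaches_run M w n, hn⟩
  · rintro ⟨c, hc, hn⟩
    obtain ⟨n, rfl⟩ := exists_run_of_reaches M w hc
    exact ⟨n, hn⟩

end run

end FoldedCfg

end Turing

/-! ### The automaton of walls, erasers and computations -/

open Turing

/-- The stages of a front, which writes the input of the Turing machine behind itself: first the
unary code of the parameter `a` (in the stages `first`, `second`, `mid`, `last`), then one symbol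
for every cell of the adjacent block of marked cells, then blanks. -/
inductive Front
  | first | second | mid | last | marked | blank
  deriving DecidableEq

instance : Finite Front :=
  Fintype.finite ⟨{.first, .second, .mid, .last, .marked, .blank}, fun f => by cases f <;> simp⟩

/-- The main layer of a cell. A wall starts a computation to its right whenever an eraser reaches
it; the computation uses the cells behind a front that moves right at speed one. A killer starts
when the computation halts, and turns the wall into an eraser, which runs on to the left. An
ordinary cell holds two symbols of a folded tape and possibly the head with its side of the tape. -/
inductive Main (Γ Q : Type)
  | wall (launch : Bool)
  | erase
  | kill
  | front (f : Front)
  | cell (sym : Bool → Γ) (head : Option (Q × Bool))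

namespace Front

/-- The stage of a front in the next cell; `z` says that the counter is used up, and `m` that the
cell entered is marked. -/
def next (z m : Bool) : Front → Front
  | first => second
  | second => mid
  | mid => if z then last else mid
  | last => if m then marked else blank
  | marked => if m then marked else blank
  | blank => blank

/-- The symbol written by a front. -/
def sym {Γ : Type} [Inhabited Γ] (s₀ s₁ s₂ : Γ) : Front → Γ
  | first => s₀
  | second => s₁
  | mid => s₂
  | last => s₁
  | marked => s₂
  | blank => default

/-- The stage of a front when it is in the cell `p` cells right of the one next to the wall, for
the parameter `a` and a block of exactly `x` marked cells that starts at `p = a + 4`. -/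
def stage (a x p : ℕ) : Front :=
  if p = 0 then first else if p = 1 then second else if p ≤ a + 2 then mid
  else if p = a + 3 then last else if p < a + 4 + x then marked else blank

lemma next_stage (a x p : ℕ) (z m : Bool)
    (hz : stage a x p = mid → (z = true ↔ p = a + 2))
    (hm : a + 3 ≤ p → p + 1 ≤ a + 4 + x → (m = true ↔ p + 1 < a + 4 + x)) :
    (stage a x p).next z m = stage a x (p + 1) := by
  unfold stage at *
  grind [next]

end Front

namespace Main

variable {Γ Q : Type} [Inhabited Γ] [Inhabited Q] (M : TM0.Machine Γ Q) (s₀ s₁ s₂ : Γ)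

/-- An ordinary blank cell. -/
def blank : Main Γ Q := cell (fun _ => default) none

/-- The head that leaves a cell, away from the wall (`out = true`) or towards it. -/
def leaving (out : Bool) : Main Γ Q → Option (Q × Bool)
  | cell t (some (q, b)) => match M q (t b) with
    | some (q', TM0.Stmt.move d) => if outward d b = out then some (q', b) else none
    | _ => none
  | _ => none

/-- The front that enters the right neighbour of a cell. -/
def emitted (z m : Bool) : Main Γ Q → Option Front
  | wall true => some .first
  | front f => some (f.next z m)
  | _ => none

/-- The new state of an ordinary cell that is neither erased nor entered by a front or a killer. -/
def cellStep (l : Main Γ Q) (t : Bool → Γ) (h : Option (Q × Bool)) (r : Main Γ Q) : Main Γ Q :=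
  match h with
  | none => cell t ((leaving M true l).or (leaving M false r))
  | some (q, b) => match M q (t b) with
    | none => kill
    | some (q', TM0.Stmt.write g) => cell (Function.update t b g) (some (q', b))
    | some (q', TM0.Stmt.move d) =>
      if outward d b then cell t none
      else match l with
        | wall _ => cell t (some (q', !b))
        | _ => cell t none

/-- The local rule on the main layer. -/
def next (z m : Bool) (l s r : Main Γ Q) : Main Γ Q :=
  match s with
  | wall b => match r with
    | erase => wall true
    | wall _ => wall b
    | kill => if b then wall false else erase
    | _ => wall false
  | erase => match r with
    | erase => erase
    | _ => blank
  | kill => match r with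
    | erase => erase
    | r => match emitted z m l with
      | some f => front f
      | none => match r with
        | kill => kill
        | _ => blank
  | front f => match r with
    | erase => erase
    | r => match emitted z m l with
      | some f' => front f'
      | none => match r with
        | wall _ => erase
        | _ => cell (fun b => if b then f.sym s₀ s₁ s₂ else default)
            (if f = .first then some (default, true) else leaving M true l)
  | cell t h => match r with
    | erase => erase
    | r => match emitted z m l with
      | some f => front f
      | none => match r with
        | kill => kill
        | r => cellStep M l t h r

variable {M s₀ s₁ s₂} {z m : Bool} {l s r : Main Γ Q}

lemma next_of_right_erase (hs : ∀ b, s ≠ wall b) : next M s₀ s₁ s₂ z m l s erase = erase := by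
  cases s <;> simp_all [next]

lemma next_quiet (hs : s ≠ erase) (hs' : ∀ b, s ≠ wall b) (hr : r ≠ erase) (hr' : ∀ b, r ≠ wall b) :
    next M s₀ s₁ s₂ z m l s r ≠ erase ∧ ∀ b, next M s₀ s₁ s₂ z m l s r ≠ wall b := by
  cases s with
  | wall b => exact absurd rfl (hs' b)
  | erase => exact absurd rfl hs
  | kill =>
    simp only [next]
    cases r <;> simp_all <;> split <;> simp [blank]
  | front f =>
    simp only [next]
    cases r <;> simp_all <;> split <;> simp
  | cell t h =>
    simp only [next]
    cases r <;> simp_all <;> split <;> try simp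
    all_goals
      unfold cellStep
      split
      · simp
      · split
        · simp
        · simp
        · split_ifs
          · simp
          · split <;> simp

lemma next_of_emitted {f : Front} (hs : s ≠ erase) (hs' : ∀ b, s ≠ wall b) (hr : r ≠ erase)
    (hl : emitted z m l = some f) : next M s₀ s₁ s₂ z m l s r = front f := by
  cases s <;> cases r <;> simp_all [next]

end Main

/-- A cell of the automaton. Besides the main layer there are a mark, which never changes, a payload
bit carried by the erasers, and the counter of a front in the stage `mid`. -/
structure CellState (Γ Q : Type) where
  main : Main Γ Q
  mark : Bool
  pay : Bool
  ctr : ℕ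

namespace CellState

variable {Γ Q : Type} [Inhabited Γ] [Inhabited Q] (M : TM0.Machine Γ Q) (s₀ s₁ s₂ : Γ)

/-- The counter sent to the right neighbour. -/
def nextCtr (a : ℕ) (l : CellState Γ Q) : ℕ :=
  match l.main with
  | .front .second => a
  | .front .mid => l.ctr - 1
  | _ => 0

/-- The payload of a cell after one step. -/
def nextPay (s r : CellState Γ Q) : Bool :=
  match r.main with
  | .erase => r.pay
  | _ => s.pay

/-- The local rule. -/
def rule (a : ℕ) (l s r : CellState Γ Q) : CellState Γ Q where
  main := Main.next M s₀ s₁ s₂ (decide (l.ctr = 0)) s.mark l.main s.main r.main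
  mark := s.mark
  pay := nextPay s r
  ctr := nextCtr a l

/-- The global map. -/
def global (a : ℕ) (y : ℤ → CellState Γ Q) : ℤ → CellState Γ Q :=
  fun i => rule M s₀ s₁ s₂ a (y (i - 1)) (y i) (y (i + 1))

/-- The content of the main layer `j` cells to the right of a wall, `s` steps after the wall has
started its computation and up to the front `j = s`, if nothing interferes. The front leaves the
head next to the wall in the second step, so that `s - 2` steps of the machine have been made. -/
def ideal (a x s j : ℕ) : Main Γ Q :=
  if j = 0 then .wall (decide (s = 0))
  else if j < s then
    let c := FoldedCfg.run M (fun p => (Front.stage a x p).sym s₀ s₁ s₂) (s - 2)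
    .cell (fun b => c.tape b (j - 1)) (if c.pos = j - 1 then some (c.state, c.side) else none)
  else .front (Front.stage a x (j - 1))

end CellState

/-! ### Computations in the undisturbed region behind a front -/

namespace Main

variable {Γ Q : Type} [Inhabited Q] {M : TM0.Machine Γ Q}

/-- The ordinary cell that displays cell `i` of a folded tape. -/
def ofFolded (c : FoldedCfg Γ Q) (i : ℕ) : Main Γ Q :=
  .cell (fun b => c.tape b i) (if c.pos = i then some (c.state, c.side) else none)

lemma leaving_ofFolded_of_ne {c : FoldedCfg Γ Q} {i : ℕ} (out : Bool) (h : c.pos ≠ i) :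
    leaving M out (ofFolded c i) = none := by
  simp [ofFolded, leaving, h]

lemma leaving_ofFolded_self (c : FoldedCfg Γ Q) (out : Bool) :
    leaving M out (ofFolded c c.pos) = match M c.state (c.tape c.side c.pos) with
      | some (q', TM0.Stmt.move d) => if outward d c.side = out then some (q', c.side) else none
      | _ => none := by
  simp only [ofFolded, leaving, if_true]

lemma leaving_true_ofFolded {c : FoldedCfg Γ Q} {i : ℕ} (h : c.pos ≤ i) :
    leaving M true (ofFolded c i) = if ((FoldedCfg.step M c).getD c).pos = i + 1 then
      some (((FoldedCfg.step M c).getD c).state, ((FoldedCfg.step M c).getD c).side) else none := by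
  by_cases hp : c.pos = i
  · subst hp
    rw [leaving_ofFolded_self, FoldedCfg.step]
    rcases M c.state (c.tape c.side c.pos) with _ | ⟨q', d | g⟩
    · simp
    · simp only
      split_ifs <;> simp_all
    · simp
  · rw [leaving_ofFolded_of_ne _ hp, if_neg]
    cases hs : FoldedCfg.step M c with
    | none => simp; omega
    | some c' => have := FoldedCfg.step_pos_le M hs; simp; omega

lemma cellStep_ofFolded {c c' : FoldedCfg Γ Q} (h : FoldedCfg.step M c = some c') {i : ℕ}
    {l r : Main Γ Q} (hl : l = if i = 0 then .wall false else ofFolded c (i - 1))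
    (hr : r = ofFolded c (i + 1) ∨ (∃ f, r = .front f) ∧ c.pos ≠ i + 1) :
    cellStep M l (fun b => c.tape b i) (if c.pos = i then some (c.state, c.side) else none) r =
      ofFolded c' i := by
  have hl0 : c.pos + 1 ≠ i → leaving M true l = none := by
    intro hne
    rw [hl]
    split_ifs with hi
    · rfl
    · exact leaving_ofFolded_of_ne _ (by omega)
  have hr0 : c.pos ≠ i + 1 → leaving M false r = none := by
    intro hne
    obtain rfl | ⟨⟨f, rfl⟩, -⟩ := hr
    · exact leaving_ofFolded_of_ne _ hne
    · rfl
  have hl1 : c.pos + 1 = i → leaving M true l = leaving M true (ofFolded c c.pos) := by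
    rintro rfl
    rw [hl, if_neg (by omega), Nat.add_sub_cancel]
  have hr1 : c.pos = i + 1 → leaving M false r = leaving M false (ofFolded c c.pos) := by
    intro he
    obtain rfl | ⟨-, hne⟩ := hr
    · rw [he]
    · exact absurd he hne
  rw [leaving_ofFolded_self] at hl1 hr1
  unfold FoldedCfg.step at h
  rcases hM : M c.state (c.tape c.side c.pos) with _ | ⟨q', d | g⟩
  · simp [hM] at h
  · simp only [hM] at h hl1 hr1
    by_cases hp : c.pos = i
    · subst hp
      simp only [cellStep, if_true, hM]
      by_cases ho : outward d c.side = true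
      · rw [if_pos ho] at h ⊢
        obtain rfl := Option.some.inj h
        simp [ofFolded]
      · rw [if_neg ho] at h ⊢
        by_cases h0 : c.pos = 0
        · rw [if_pos h0] at h hl
          obtain rfl := Option.some.inj h
          simp [hl, ofFolded, h0]
        · rw [if_neg h0] at h hl
          obtain rfl := Option.some.inj h
          simp only [hl, ofFolded]
          rw [if_neg (by omega : ¬ c.pos - 1 = c.pos)]
    · simp only [if_neg hp, cellStep]
      by_cases ho : outward d c.side = true
      · rw [if_pos ho] at h
        obtain rfl := Option.some.inj h
        simp only [ho, if_true] at hl1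
        have : leaving M false r = none := by
          by_cases he : c.pos = i + 1
          · simp [hr1 he, ho]
          · exact hr0 he
        rw [this]
        by_cases he : c.pos + 1 = i
        · simp [hl1 he, ofFolded, he]
        · simp [hl0 he, ofFolded, he]
      · rw [if_neg ho] at h
        have : leaving M true l = none := by
          by_cases he : c.pos + 1 = i
          · simp [hl1 he, ho]
          · exact hl0 he
        rw [this]
        have ho' : outward d c.side = false := by simpa using ho
        simp only [ho', if_true] at hr1
        by_cases h0 : c.pos = 0
        · rw [if_pos h0] at h
          obtain rfl := Option.some.inj h
          simp [hr0 (by omega), ofFolded, show ¬ 0 = i by omega]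
        · rw [if_neg h0] at h
          obtain rfl := Option.some.inj h
          by_cases he : c.pos = i + 1
          · simp [hr1 he, ofFolded, he]
          · simp [hr0 he, ofFolded, show ¬ c.pos - 1 = i by omega]
  · simp only [hM] at h hl1 hr1
    obtain rfl := Option.some.inj h
    by_cases hp : c.pos = i
    · subst hp
      simp only [cellStep, if_true, hM, ofFolded]
      congr 1
      funext b
      by_cases hb : b = c.side
      · subst hb; simp
      · simp [hb]
    · have h1 : leaving M true l = none := by
        by_cases he : c.pos + 1 = i
        · simp [hl1 he]
        · exact hl0 he
      have h2 : leaving M false r = none := by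
        by_cases he : c.pos = i + 1
        · simp [hr1 he]
        · exact hr0 he
      simp only [cellStep, if_neg hp, h1, h2, ofFolded]
      congr 1
      funext b
      by_cases hb : b = c.side
      · subst hb; simp [Ne.symm hp]
      · simp [hb]

lemma next_cell [Inhabited Γ] {s₀ s₁ s₂ : Γ} {z m : Bool} {l r : Main Γ Q} {t : Bool → Γ}
    {h : Option (Q × Bool)}
    (hl : l = .wall false ∨ ∃ t' h', l = .cell t' h')
    (hr : (∃ f, r = .front f) ∨ ∃ t' h', r = .cell t' h') :
    next M s₀ s₁ s₂ z m l (.cell t h) r = cellStep M l t h r := by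
  obtain rfl | ⟨t', h', rfl⟩ := hl <;> obtain ⟨f, rfl⟩ | ⟨t'', h'', rfl⟩ := hr <;> rfl

end Main

namespace CellState

variable {Γ Q : Type} [Inhabited Γ] [Inhabited Q] {M : TM0.Machine Γ Q} {s₀ s₁ s₂ : Γ} {a x : ℕ}

/-- The input of the Turing machine that the front writes. -/
def input (s₀ s₁ s₂ : Γ) (a x p : ℕ) : Γ := (Front.stage a x p).sym s₀ s₁ s₂

lemma ideal_zero (s : ℕ) : ideal M s₀ s₁ s₂ a x s 0 = .wall (decide (s = 0)) := if_pos rfl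

lemma ideal_inner {n i : ℕ} (h : i ≤ n) : ideal M s₀ s₁ s₂ a x (n + 2) (i + 1) =
    Main.ofFolded (FoldedCfg.run M (input s₀ s₁ s₂ a x) n) i := by
  rw [ideal, if_neg (by omega), if_pos (by omega)]
  rfl

lemma ideal_front (s : ℕ) :
    ideal M s₀ s₁ s₂ a x (s + 1) (s + 1) = .front (Front.stage a x s) := by
  rw [ideal, if_neg (by omega), if_neg (by omega)]
  rfl

/-- One step of the automaton in the interior of the region of the computation. -/
lemma next_ideal_inner {n i : ℕ} (h : i ≤ n) (z m : Bool)
    (hstep : FoldedCfg.step M (FoldedCfg.run M (input s₀ s₁ s₂ a x) n) ≠ none) :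
    Main.next M s₀ s₁ s₂ z m (ideal M s₀ s₁ s₂ a x (n + 2) i)
      (ideal M s₀ s₁ s₂ a x (n + 2) (i + 1)) (ideal M s₀ s₁ s₂ a x (n + 2) (i + 2)) =
    ideal M s₀ s₁ s₂ a x (n + 3) (i + 1) := by
  obtain ⟨c', hc'⟩ := Option.ne_none_iff_exists'.1 hstep
  have hrun := FoldedCfg.run_succ_eq M _ hc'
  have hl : ideal M s₀ s₁ s₂ a x (n + 2) i = if i = 0 then .wall false else
      Main.ofFolded (FoldedCfg.run M (input s₀ s₁ s₂ a x) n) (i - 1) := by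
    cases i with
    | zero => rw [ideal_zero]; simp
    | succ i => rw [ideal_inner (by omega)]; rfl
  have hr : ideal M s₀ s₁ s₂ a x (n + 2) (i + 2) =
        Main.ofFolded (FoldedCfg.run M (input s₀ s₁ s₂ a x) n) (i + 1) ∨
      (∃ f, ideal M s₀ s₁ s₂ a x (n + 2) (i + 2) = .front f) ∧
        (FoldedCfg.run M (input s₀ s₁ s₂ a x) n).pos ≠ i + 1 := by
    rcases Nat.lt_or_ge i n with hi | hi
    · exact Or.inl (ideal_inner (by omega))
    · obtain rfl : i = n := by omega
      refine Or.inr ⟨⟨_, ideal_front (i + 1)⟩, ?_⟩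
      have := FoldedCfg.run_pos_le M (input s₀ s₁ s₂ a x) i
      omega
  rw [ideal_inner h, ideal_inner (n := n + 1) (by omega), hrun,
    ← Main.cellStep_ofFolded hc' hl hr]
  refine Main.next_cell ?_ ?_
  · rw [hl]
    split_ifs
    · exact Or.inl rfl
    · exact Or.inr ⟨_, _, rfl⟩
  · obtain hr | ⟨hr, -⟩ := hr
    · rw [hr]; exact Or.inr ⟨_, _, rfl⟩
    · exact Or.inl hr

/-- The wall does not change while its front moves on. -/
lemma next_ideal_zero (s : ℕ) (z m : Bool) (l : Main Γ Q) :
    Main.next M s₀ s₁ s₂ z m l (ideal M s₀ s₁ s₂ a x (s + 1) 0)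
      (ideal M s₀ s₁ s₂ a x (s + 1) 1) = ideal M s₀ s₁ s₂ a x (s + 2) 0 := by
  rw [ideal_zero, ideal_zero]
  cases s with
  | zero => rw [ideal_front]; rfl
  | succ s => rw [ideal_inner (by omega)]; rfl

/-- The front turns into an ordinary cell with one symbol of the input; the first one sets the
head of the Turing machine. -/
lemma next_ideal_front (s : ℕ) (z m : Bool) {r : Main Γ Q} (hr : r ≠ .erase)
    (hr' : ∀ b, r ≠ .wall b) :
    Main.next M s₀ s₁ s₂ z m (ideal M s₀ s₁ s₂ a x (s + 1) s)
      (ideal M s₀ s₁ s₂ a x (s + 1) (s + 1)) r = ideal M s₀ s₁ s₂ a x (s + 2) (s + 1) := by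
  have hl : Main.emitted z m (ideal M s₀ s₁ s₂ a x (s + 1) s) = none := by
    cases s with
    | zero => rw [ideal_zero]; rfl
    | succ s => rw [ideal_inner le_rfl]; rfl
  rw [ideal_front, ideal_inner le_rfl]
  have htape := fun b => FoldedCfg.run_tape M (input s₀ s₁ s₂ a x) (n := s) (i := s) b le_rfl
  have hfirst : Front.stage a x s = .first ↔ s = 0 := by
    unfold Front.stage
    grind
  have hhead : (if Front.stage a x s = .first then some ((default : Q), true)
        else Main.leaving M true (ideal M s₀ s₁ s₂ a x (s + 1) s)) =
      if (FoldedCfg.run M (input s₀ s₁ s₂ a x) s).pos = s then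
        some ((FoldedCfg.run M (input s₀ s₁ s₂ a x) s).state,
          (FoldedCfg.run M (input s₀ s₁ s₂ a x) s).side) else none := by
    cases s with
    | zero => rw [if_pos (hfirst.2 rfl)]; rfl
    | succ s =>
      rw [if_neg (by rw [hfirst]; omega), ideal_inner le_rfl,
        Main.leaving_true_ofFolded (FoldedCfg.run_pos_le _ _ _), ← FoldedCfg.run_succ]
  rw [Main.ofFolded, ← hhead]
  simp only [htape]
  cases r <;> simp_all [Main.next] <;> rfl

end CellState

/-! ### Computations started by a wall -/

namespace CellState

section

variable {Γ Q : Type} {i₀ : ℤ} {y : ℤ → CellState Γ Q}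

/-- A killer runs towards the wall at `i₀` and has reached the cell `i₀ + p + 1`. -/
def KillAt (i₀ : ℤ) (y : ℤ → CellState Γ Q) (p : ℕ) : Prop :=
  (y (i₀ + (0 : ℕ))).main = .wall false ∧
    (∀ j < p, ∃ t, (y (i₀ + (j + 1 : ℕ))).main = .cell t none) ∧
    (y (i₀ + (p + 1 : ℕ))).main = .kill

lemma KillAt.left {p j : ℕ} (hy : KillAt i₀ y p) (hj : j ≤ p) :
    (y (i₀ + j)).main = .wall false ∨ ∃ t, (y (i₀ + j)).main = .cell t none := by
  cases j with
  | zero => exact Or.inl hy.1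
  | succ j => exact Or.inr (hy.2.1 j (by omega))

end

variable {Γ Q : Type} [Inhabited Γ] [Inhabited Q] {M : TM0.Machine Γ Q} {s₀ s₁ s₂ : Γ} {a x : ℕ}
  {i₀ : ℤ} {y : ℤ → CellState Γ Q} {s h : ℕ}

lemma global_main (i : ℤ) : (global M s₀ s₁ s₂ a y i).main =
    Main.next M s₀ s₁ s₂ (decide ((y (i - 1)).ctr = 0)) (y i).mark (y (i - 1)).main (y i).main
      (y (i + 1)).main := rfl

lemma global_main_succ (i : ℤ) (j : ℕ) : (global M s₀ s₁ s₂ a y (i + (j + 1 : ℕ))).main =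
    Main.next M s₀ s₁ s₂ (decide ((y (i + j)).ctr = 0)) (y (i + (j + 1 : ℕ))).mark (y (i + j)).main
      (y (i + (j + 1 : ℕ))).main (y (i + (j + 2 : ℕ))).main := by
  rw [global_main, show i + ((j + 1 : ℕ) : ℤ) - 1 = i + j by push_cast; ring,
    show i + ((j + 1 : ℕ) : ℤ) + 1 = i + (j + 2 : ℕ) by push_cast; ring]

lemma global_main_zero (i : ℤ) : (global M s₀ s₁ s₂ a y (i + (0 : ℕ))).main =
    Main.next M s₀ s₁ s₂ (decide ((y (i - 1)).ctr = 0)) (y (i + (0 : ℕ))).mark (y (i - 1)).main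
      (y (i + (0 : ℕ))).main (y (i + (1 : ℕ))).main := by
  simp [global_main]

/-- The cells `0, …, h` to the right of `i₀` are those of the undisturbed computation after `s`
steps. -/
def Agree (M : TM0.Machine Γ Q) (s₀ s₁ s₂ : Γ) (a x : ℕ) (i₀ : ℤ) (y : ℤ → CellState Γ Q)
    (s h : ℕ) : Prop :=
  ∀ j ≤ h, (y (i₀ + j)).main = ideal M s₀ s₁ s₂ a x s j

/-- The configuration `y` contains a computation started by a wall at `i₀` whose front has reached
the cell `i₀ + s`. -/
def FrontAt (M : TM0.Machine Γ Q) (s₀ s₁ s₂ : Γ) (a x : ℕ) (i₀ : ℤ) (y : ℤ → CellState Γ Q)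
    (s : ℕ) : Prop :=
  Agree M s₀ s₁ s₂ a x i₀ y s s ∧
    ∀ s', s = s' + 1 → Front.stage a x s' = .mid → (y (i₀ + s)).ctr = a + 2 - s'

/-- The configuration `y` contains a computation started by a wall at `i₀` that is being erased; the
eraser has reached the cell `i₀ + h + 1`. -/
def BrokenAt (M : TM0.Machine Γ Q) (s₀ s₁ s₂ : Γ) (a x : ℕ) (i₀ : ℤ) (y : ℤ → CellState Γ Q)
    (s h : ℕ) : Prop :=
  h < s ∧ Agree M s₀ s₁ s₂ a x i₀ y s h ∧ (y (i₀ + (h + 1 : ℕ))).main = .erase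

/-- The block of marked cells that belongs to a wall at `i₀` has length `x`. -/
def MarksAt (a x : ℕ) (i₀ : ℤ) (y : ℤ → CellState Γ Q) : Prop :=
  ∀ p, a + 4 ≤ p → p ≤ a + 4 + x → ((y (i₀ + (p + 1 : ℕ))).mark = true ↔ p < a + 4 + x)

lemma FrontAt.main_front {s' : ℕ} (hy : FrontAt M s₀ s₁ s₂ a x i₀ y (s' + 1)) :
    (y (i₀ + (s' + 1 : ℕ))).main = .front (Front.stage a x s') := by
  rw [hy.1 _ le_rfl, ideal_front]

lemma frontAt_zero (hy : (y i₀).main = .wall true) : FrontAt M s₀ s₁ s₂ a x i₀ y 0 := by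
  refine ⟨fun j hj => ?_, fun s' hs' => by omega⟩
  obtain rfl : j = 0 := by omega
  rw [ideal_zero]
  simpa using hy

/-- The machine has not halted in the computation that is displayed after `s` steps. -/
def Running (M : TM0.Machine Γ Q) (s₀ s₁ s₂ : Γ) (a x s : ℕ) : Prop :=
  ∀ n, s = n + 2 → FoldedCfg.step M (FoldedCfg.run M (input s₀ s₁ s₂ a x) n) ≠ none

/-- The undisturbed region makes a step of its own, except for its last cell. -/
lemma Agree.global_of_lt (hy : Agree M s₀ s₁ s₂ a x i₀ y s h) (hs : h ≤ s)
    (hrun : Running M s₀ s₁ s₂ a x s) {j : ℕ} (hj : j < h) :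
    (global M s₀ s₁ s₂ a y (i₀ + j)).main = ideal M s₀ s₁ s₂ a x (s + 1) j := by
  cases j with
  | zero =>
    obtain ⟨s, rfl⟩ : ∃ s', s = s' + 1 := ⟨s - 1, by omega⟩
    rw [global_main_zero, hy 0 (by omega), hy 1 (by omega)]
    exact next_ideal_zero _ _ _ _
  | succ j =>
    obtain ⟨n, rfl⟩ : ∃ n, s = n + 2 := ⟨s - 2, by omega⟩
    rw [global_main_succ, hy j (by omega), hy (j + 1) (by omega), hy (j + 2) (by omega)]
    exact next_ideal_inner (by omega) _ _ (hrun n rfl)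

/-- If neither an eraser nor a wall is in front of it, the front leaves a correct cell behind. -/
lemma FrontAt.agree_global (hy : FrontAt M s₀ s₁ s₂ a x i₀ y s)
    (hrun : Running M s₀ s₁ s₂ a x s)
    (h1 : (y (i₀ + (s + 1 : ℕ))).main ≠ .erase) (h2 : ∀ b, (y (i₀ + (s + 1 : ℕ))).main ≠ .wall b) :
    Agree M s₀ s₁ s₂ a x i₀ (global M s₀ s₁ s₂ a y) (s + 1) s := by
  intro j hj
  rcases Nat.lt_or_ge j s with hjs | hjs
  · exact hy.1.global_of_lt le_rfl hrun hjs
  obtain rfl : j = s := by omega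
  cases j with
  | zero =>
    rw [global_main_zero, hy.1 0 le_rfl, ideal_zero, ideal_zero]
    generalize (y (i₀ + (1 : ℕ))).main = r at *
    cases r <;> simp_all [Main.next]
  | succ s' =>
    rw [global_main_succ, hy.1 s' (by omega), hy.1 (s' + 1) le_rfl]
    exact next_ideal_front _ _ _ h1 h2

/-- In the absence of erasers and walls, the front moves on. -/
lemma FrontAt.global (hy : FrontAt M s₀ s₁ s₂ a x i₀ y s) (hm : MarksAt a x i₀ y)
    (hrun : Running M s₀ s₁ s₂ a x s)
    (h1 : (y (i₀ + (s + 1 : ℕ))).main ≠ .erase) (h2 : ∀ b, (y (i₀ + (s + 1 : ℕ))).main ≠ .wall b)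
    (h3 : (y (i₀ + (s + 2 : ℕ))).main ≠ .erase) :
    FrontAt M s₀ s₁ s₂ a x i₀ (global M s₀ s₁ s₂ a y) (s + 1) := by
  refine ⟨fun j hj => ?_, ?_⟩
  · rcases Nat.lt_or_ge j (s + 1) with hjs | hjs
    · exact hy.agree_global hrun h1 h2 j (by omega)
    obtain rfl : j = s + 1 := by omega
    rw [global_main_succ, ideal_front]
    refine Main.next_of_emitted h1 h2 h3 ?_
    cases s with
    | zero => rw [hy.1 0 le_rfl, ideal_zero]; rfl
    | succ s' =>
      rw [hy.main_front]
      refine congrArg some (Front.next_stage _ _ _ _ _ (fun hmid => ?_) fun hp hp' => ?_)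
      · have := hy.2 s' rfl hmid
        have hle : s' ≤ a + 2 := by
          unfold Front.stage at hmid
          grind
        rw [this]
        simp
        omega
      · exact hm (s' + 1) (by omega) (by omega)
  · rintro s' hs' hmid
    obtain rfl : s = s' := by omega
    have hge : 2 ≤ s ∧ s ≤ a + 2 := by
      unfold Front.stage at hmid
      grind
    obtain ⟨s, rfl⟩ : ∃ s', s = s' + 1 := ⟨s - 1, by omega⟩
    change nextCtr a (y (i₀ + ((s + 1 + 1 : ℕ) : ℤ) - 1)) = _
    rw [show i₀ + ((s + 1 + 1 : ℕ) : ℤ) - 1 = i₀ + (s + 1 : ℕ) by push_cast; ring]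
    have hfr := hy.main_front
    simp only [nextCtr, hfr]
    rcases Nat.lt_or_ge s 2 with h2 | h2
    · obtain rfl : s = 1 := by omega
      simp [Front.stage]
    · have hst : Front.stage a x s = .mid := by
        unfold Front.stage
        grind
      rw [hst]
      simp only
      rw [hy.2 s rfl hst]
      omega

/-- A wall whose machine never halts: its computation goes on or is erased. -/
def Persists (M : TM0.Machine Γ Q) (s₀ s₁ s₂ : Γ) (a x : ℕ) (i₀ : ℤ) (y : ℤ → CellState Γ Q) :
    Prop :=
  ∃ s, FrontAt M s₀ s₁ s₂ a x i₀ y s ∨ ∃ h, BrokenAt M s₀ s₁ s₂ a x i₀ y s h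

lemma Persists.main_eq_wall (hy : Persists M s₀ s₁ s₂ a x i₀ y) : ∃ b, (y i₀).main = .wall b := by
  obtain ⟨s, hy | ⟨h, -, hy, -⟩⟩ := hy
  · exact ⟨_, by simpa [ideal_zero] using hy.1 0 (by omega)⟩
  · exact ⟨_, by simpa [ideal_zero] using hy 0 (by omega)⟩

lemma main_ne_wall_of_agree (hy : Agree M s₀ s₁ s₂ a x i₀ y s h) {j : ℕ} (hj : j + 1 ≤ h)
    (b : Bool) :
    (y (i₀ + (j + 1 : ℕ))).main ≠ .wall b := by
  rw [hy _ hj, ideal, if_neg (by omega)]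
  split_ifs <;> simp

/-- If the machine of a wall never halts, the wall lasts forever, whatever happens around it. -/
lemma Persists.global (hy : Persists M s₀ s₁ s₂ a x i₀ y) (hm : MarksAt a x i₀ y)
    (hrun : ∀ n, FoldedCfg.step M (FoldedCfg.run M (input s₀ s₁ s₂ a x) n) ≠ none) :
    Persists M s₀ s₁ s₂ a x i₀ (global M s₀ s₁ s₂ a y) := by
  have hrun' : ∀ s, Running M s₀ s₁ s₂ a x s := fun s n _ => hrun n
  obtain ⟨s, hy | ⟨h, hhs, hy, he⟩⟩ := hy
  · by_cases h1 : (y (i₀ + (s + 1 : ℕ))).main = .erase ∨ ∃ b, (y (i₀ + (s + 1 : ℕ))).main = .wall b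
    · cases s with
      | zero =>
        refine ⟨0, Or.inl (frontAt_zero ?_)⟩
        have := global_main_zero (M := M) (s₀ := s₀) (s₁ := s₁) (s₂ := s₂) (a := a) (y := y) i₀
        rw [hy.1 0 le_rfl, ideal_zero] at this
        simp only [zero_add] at h1
        obtain h1 | ⟨b, h1⟩ := h1 <;> rw [h1] at this <;> simpa [Main.next] using this
      | succ s =>
        refine ⟨s + 2, Or.inr ⟨s, by omega,
          fun j hj => hy.1.global_of_lt le_rfl (hrun' _) (by omega), ?_⟩⟩
        rw [global_main_succ, hy.main_front, hy.1 s (by omega)]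
        have hl : ∀ z m, Main.emitted z m (ideal M s₀ s₁ s₂ a x (s + 1) s) = none := by
          intro z m
          cases s with
          | zero => rw [ideal_zero]; rfl
          | succ s => rw [ideal_inner le_rfl]; rfl
        obtain h1 | ⟨b, h1⟩ := h1 <;> rw [h1] <;> simp [Main.next, hl]
    · push Not at h1
      by_cases h3 : (y (i₀ + (s + 2 : ℕ))).main = .erase
      · refine ⟨s + 1, Or.inr ⟨s, by omega, hy.agree_global (hrun' _) h1.1 h1.2, ?_⟩⟩
        rw [global_main_succ, h3]
        exact Main.next_of_right_erase h1.2
      · exact ⟨s + 1, Or.inl (hy.global hm (hrun' _) h1.1 h1.2 h3)⟩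
  · cases h with
    | zero =>
      refine ⟨0, Or.inl (frontAt_zero ?_)⟩
      have := global_main_zero (M := M) (s₀ := s₀) (s₁ := s₁) (s₂ := s₂) (a := a) (y := y) i₀
      rw [hy 0 le_rfl, ideal_zero] at this
      simp only [zero_add] at he
      rw [he] at this
      simpa [Main.next] using this
    | succ h =>
      refine ⟨s + 1, Or.inr ⟨h, by omega,
        fun j hj => hy.global_of_lt (by omega) (hrun' _) (by omega), ?_⟩⟩
      rw [global_main_succ, he]
      exact Main.next_of_right_erase (main_ne_wall_of_agree hy le_rfl)

/-- There are no erasers and no walls to the right of the cell `i`. -/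
def Quiet (y : ℤ → CellState Γ Q) (i : ℤ) : Prop :=
  ∀ j, i < j → (y j).main ≠ .erase ∧ ∀ b, (y j).main ≠ .wall b

lemma Quiet.global {i : ℤ} (hy : Quiet y i) : Quiet (global M s₀ s₁ s₂ a y) i := fun j hj =>
  Main.next_quiet (hy j hj).1 (hy j hj).2 (hy (j + 1) (by omega)).1 (hy (j + 1) (by omega)).2

lemma Quiet.pay_global {i : ℤ} (hy : Quiet y i) :
    (CellState.global M s₀ s₁ s₂ a y i).pay = (y i).pay := by
  have := (hy (i + 1) (by omega)).1
  change nextPay _ _ = _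
  unfold nextPay
  split
  · contradiction
  · rfl

lemma Quiet.iterate {i : ℤ} (hy : Quiet y i) (t : ℕ) :
    Quiet ((CellState.global M s₀ s₁ s₂ a)^[t] y) i ∧
      ((CellState.global M s₀ s₁ s₂ a)^[t] y i).pay = (y i).pay := by
  induction t with
  | zero => exact ⟨hy, rfl⟩
  | succ t ih =>
    rw [Function.iterate_succ_apply']
    exact ⟨ih.1.global, ih.1.pay_global.trans ih.2⟩

lemma iterate_mark (t : ℕ) (i : ℤ) :
    ((CellState.global M s₀ s₁ s₂ a)^[t] y i).mark = (y i).mark := by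
  induction t with
  | zero => rfl
  | succ t ih =>
    rw [Function.iterate_succ_apply']
    exact ih

lemma MarksAt.iterate (hm : MarksAt a x i₀ y) (t : ℕ) :
    MarksAt a x i₀ ((CellState.global M s₀ s₁ s₂ a)^[t] y) := by
  intro p hp hp'
  rw [iterate_mark]
  exact hm p hp hp'

lemma KillAt.global {p : ℕ} (hy : KillAt i₀ y (p + 1)) :
    KillAt i₀ (global M s₀ s₁ s₂ a y) p := by
  refine ⟨?_, fun j hj => ?_, ?_⟩
  · obtain ⟨t, ht⟩ := hy.2.1 0 (by omega)
    rw [global_main_zero, hy.1, ht]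
    rfl
  · obtain ⟨t, ht⟩ := hy.2.1 j (by omega)
    obtain ⟨t', ht'⟩ := hy.2.1 (j + 1) (by omega)
    refine ⟨t, ?_⟩
    rw [global_main_succ, ht, ht']
    obtain hl | ⟨t'', hl⟩ := hy.left (j := j) (by omega) <;> rw [hl] <;> rfl
  · obtain ⟨t, ht⟩ := hy.2.1 p (by omega)
    rw [global_main_succ, ht, hy.2.2]
    obtain hl | ⟨t'', hl⟩ := hy.left (j := p) (by omega) <;> rw [hl] <;> rfl

lemma KillAt.exists_erase {p : ℕ} (hy : KillAt i₀ y p) :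
    ∃ t, ((CellState.global M s₀ s₁ s₂ a)^[t] y i₀).main = .erase := by
  induction p generalizing y with
  | zero =>
    refine ⟨1, ?_⟩
    have := global_main_zero (M := M) (s₀ := s₀) (s₁ := s₁) (s₂ := s₂) (a := a) (y := y) i₀
    rw [hy.1, hy.2.2] at this
    simpa [Main.next] using this
  | succ p ih =>
    obtain ⟨t, ht⟩ := ih (hy.global (M := M) (s₀ := s₀) (s₁ := s₁) (s₂ := s₂) (a := a))
    exact ⟨t + 1, ht⟩

/-- A halting configuration of the machine creates a killer. -/
lemma FrontAt.killAt {n : ℕ} (hy : FrontAt M s₀ s₁ s₂ a x i₀ y (n + 2))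
    (hhalt : FoldedCfg.step M (FoldedCfg.run M (input s₀ s₁ s₂ a x) n) = none) :
    ∃ p, KillAt i₀ (CellState.global M s₀ s₁ s₂ a y) p := by
  set c := FoldedCfg.run M (input s₀ s₁ s₂ a x) n with hc
  have hM : M c.state (c.tape c.side c.pos) = none := by
    unfold FoldedCfg.step at hhalt
    split at hhalt
    · assumption
    · simp at hhalt
    · split_ifs at hhalt
  have hpos : c.pos ≤ n := FoldedCfg.run_pos_le _ _ _
  have hin : ∀ i ≤ n, (y (i₀ + (i + 1 : ℕ))).main = Main.ofFolded c i := fun i hi => by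
    rw [hy.1 _ (by omega), ideal_inner hi]
  have hleft : ∀ i ≤ c.pos, (y (i₀ + i)).main = .wall false ∨
      ∃ t, (y (i₀ + i)).main = .cell t none := by
    intro i hi
    cases i with
    | zero => left; rw [hy.1 _ (by omega), ideal_zero]; simp
    | succ i =>
      refine Or.inr ⟨fun b => c.tape b i, ?_⟩
      rw [hin i (by omega), Main.ofFolded, if_neg (by omega)]
  have hlv : ∀ out, Main.leaving M out (Main.ofFolded c c.pos) = none := by
    intro out
    rw [Main.leaving_ofFolded_self, hM]
  refine ⟨c.pos, ?_, fun j hj => ⟨fun b => c.tape b j, ?_⟩, ?_⟩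
  · rw [global_main_zero, hy.1 0 (by omega), ideal_zero, hin 0 (by omega)]
    rfl
  · rw [global_main_succ, hin j (by omega), hin (j + 1) (by omega)]
    have hr : Main.leaving M false (Main.ofFolded c (j + 1)) = none := by
      by_cases he : j + 1 = c.pos
      · rw [he]; exact hlv false
      · exact Main.leaving_ofFolded_of_ne _ (by omega)
    obtain hl | ⟨t, hl⟩ := hleft j (by omega) <;> rw [hl, Main.ofFolded, if_neg (by omega)] <;>
      simp [Main.next, Main.emitted, Main.ofFolded, Main.cellStep] <;>
      exact ⟨rfl, hr⟩
  · rw [global_main_succ, hin _ hpos, Main.ofFolded, if_pos rfl]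
    have hr : (∃ f, (y (i₀ + (c.pos + 2 : ℕ))).main = .front f) ∨
        ∃ t, (y (i₀ + (c.pos + 2 : ℕ))).main = .cell t none := by
      rcases Nat.lt_or_ge c.pos n with hlt | hge
      · refine Or.inr ⟨fun b => c.tape b (c.pos + 1), ?_⟩
        rw [hin (c.pos + 1) (by omega), Main.ofFolded, if_neg (by omega)]
      · left
        rw [show c.pos + 2 = n + 1 + 1 by omega]
        exact ⟨_, hy.main_front⟩
    obtain hl | ⟨t, hl⟩ := hleft c.pos le_rfl <;> obtain ⟨f, hr⟩ | ⟨t', hr⟩ := hr <;>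
      rw [hl, hr] <;> simp [Main.next, Main.emitted, Main.cellStep, hM]

/-- If there are no erasers and walls on its right, and its machine halts, then a wall eventually
turns into an eraser. -/
lemma exists_erase_of_halts (hy : (y i₀).main = .wall true) (hq : Quiet y i₀)
    (hm : MarksAt a x i₀ y)
    (hhalt : ∃ n, FoldedCfg.step M (FoldedCfg.run M (input s₀ s₁ s₂ a x) n) = none) :
    ∃ t, ((CellState.global M s₀ s₁ s₂ a)^[t] y i₀).main = .erase := by
  classical
  set N := Nat.find hhalt with hN
  have hfront : ∀ s, s ≤ N + 2 →
      FrontAt M s₀ s₁ s₂ a x i₀ ((CellState.global M s₀ s₁ s₂ a)^[s] y) s := by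
    intro s
    induction s with
    | zero => intro _; exact frontAt_zero hy
    | succ s ih =>
      intro hs
      rw [Function.iterate_succ_apply']
      have hq' := (hq.iterate (M := M) (s₀ := s₀) (s₁ := s₁) (s₂ := s₂) (a := a) s).1
      refine (ih (by omega)).global (hm.iterate s) ?_ (hq' _ (by omega)).1 (hq' _ (by omega)).2
        (hq' _ (by omega)).1
      rintro n rfl
      exact Nat.find_min hhalt (by omega)
  obtain ⟨p, hp⟩ := (hfront (N + 2) le_rfl).killAt (Nat.find_spec hhalt)
  rw [← Function.iterate_succ_apply' (CellState.global M s₀ s₁ s₂ a)] at hp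
  obtain ⟨t, ht⟩ := hp.exists_erase (M := M) (s₀ := s₀) (s₁ := s₁) (s₂ := s₂) (a := a)
  rw [← Function.iterate_add_apply] at ht
  exact ⟨_, ht⟩

end CellState

/-! ### Blocking words and erasable words -/

namespace CellState

section

variable {Γ Q : Type} {a : ℕ} {y z : ℤ → CellState Γ Q}

/-- The configurations `y` and `z` differ in the payload at most. -/
def Twin (y z : ℤ → CellState Γ Q) : Prop :=
  ∀ i, (y i).main = (z i).main ∧ (y i).mark = (z i).mark ∧ (y i).ctr = (z i).ctr

lemma Twin.quiet (h : Twin y z) {i : ℤ} (hq : Quiet y i) : Quiet z i := fun j hj => by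
  rw [← (h j).1]
  exact hq j hj

lemma exists_marksAt (i₀ : ℤ) {K : ℤ} (hK : ∀ j, K < j → (y j).mark = false) :
    ∃ x, MarksAt a x i₀ y := by
  classical
  have hex : ∃ k : ℕ, (y (i₀ + (a + 4 + k + 1 : ℕ))).mark = false :=
    ⟨(K - i₀).toNat, hK _ (by push_cast; omega)⟩
  refine ⟨Nat.find hex, fun p hp hp' => ?_⟩
  obtain ⟨k, rfl⟩ : ∃ k, p = a + 4 + k := ⟨p - (a + 4), by omega⟩
  constructor
  · intro hmark
    by_contra hlt
    have hk : k = Nat.find hex := by omega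
    have := Nat.find_spec hex
    rw [← hk, hmark] at this
    simp at this
  · intro hlt
    simpa using Nat.find_min hex (m := k) (by omega)

end

variable {Γ Q : Type} [Inhabited Γ] [Inhabited Q] {M : TM0.Machine Γ Q} {s₀ s₁ s₂ : Γ} {a : ℕ}

/-- The configuration with walls on the cells `i ≤ 2`, the last of which starts a computation on a
block of `x` marked cells. -/
def wallConfig (Γ Q : Type) [Inhabited Γ] (a x : ℕ) (i : ℤ) : CellState Γ Q :=
  if i ≤ 2 then ⟨.wall (decide (i = 2)), false, false, 0⟩
  else ⟨.blank, decide (a + 7 ≤ i ∧ i < a + 7 + x), false, 0⟩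

/-- If the machine does not halt on `a` and `x`, then `wallConfig` contains a blocking word. -/
lemma iterate_eq_wall {x : ℕ}
    (hrun : ∀ n, FoldedCfg.step M (FoldedCfg.run M (input s₀ s₁ s₂ a x) n) ≠ none)
    {y : ℤ → CellState Γ Q}
    (hy : ∀ i : ℤ, i.natAbs ≤ a + x + 7 → y i = wallConfig Γ Q a x i) (t : ℕ) {i : ℤ}
    (hi : i.natAbs ≤ 1) : (global M s₀ s₁ s₂ a)^[t] y i = ⟨.wall false, false, false, 0⟩ := by
  have hm : MarksAt a x 2 y := by
    intro p hp hp'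
    rw [hy _ (by omega), wallConfig, if_neg (by omega)]
    simp
    omega
  -- The counter of the cell `-7` may be set from the left by the unknown cell `-8`; that of a cell
  -- to the right of a wall becomes `0`.
  have key : Persists M s₀ s₁ s₂ a x 2 ((global M s₀ s₁ s₂ a)^[t] y) ∧
      ∀ i : ℤ, -7 ≤ i → i ≤ 1 → ((global M s₀ s₁ s₂ a)^[t] y i).main = .wall false ∧
        ((global M s₀ s₁ s₂ a)^[t] y i).pay = false ∧
        (-7 < i → ((global M s₀ s₁ s₂ a)^[t] y i).ctr = 0) := by
    induction t with
    | zero =>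
      refine ⟨⟨0, Or.inl (frontAt_zero ?_)⟩, fun i h1 h2 => ?_⟩
      · rw [Function.iterate_zero_apply, hy _ (by omega)]
        simp [wallConfig]
      · rw [Function.iterate_zero_apply, hy _ (by omega), wallConfig, if_pos (by omega)]
        simp
        omega
    | succ t ih =>
      rw [Function.iterate_succ_apply']
      generalize hz : (global M s₀ s₁ s₂ a)^[t] y = z at ih
      obtain ⟨hP, hW⟩ := ih
      refine ⟨hP.global (hz ▸ hm.iterate t) hrun, fun i h1 h2 => ?_⟩
      obtain ⟨b, hb⟩ : ∃ b, (z (i + 1)).main = .wall b := by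
        by_cases h : i = 1
        · subst h; exact hP.main_eq_wall
        · exact ⟨_, (hW (i + 1) (by omega) (by omega)).1⟩
      obtain ⟨h3, h4, -⟩ := hW i h1 h2
      refine ⟨?_, ?_, fun h => ?_⟩
      · rw [global_main, h3, hb]; rfl
      · change nextPay _ _ = _
        rw [nextPay, hb]
        exact h4
      · change nextCtr _ _ = _
        rw [nextCtr, (hW (i - 1) (by omega) (by omega)).1]
  obtain ⟨h1, h2, h3⟩ := key.2 i (by omega) (by omega)
  have h4 : ((global M s₀ s₁ s₂ a)^[t] y i).mark = false := by
    rw [iterate_mark, hy _ (by omega), wallConfig, if_pos (by omega)]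
  have h5 := h3 (by omega)
  generalize (global M s₀ s₁ s₂ a)^[t] y i = c at *
  cases c
  simp_all

variable {y z : ℤ → CellState Γ Q}

lemma Twin.global (h : Twin y z) : Twin (global M s₀ s₁ s₂ a y) (global M s₀ s₁ s₂ a z) := by
  intro i
  refine ⟨?_, (h i).2.1, ?_⟩
  · rw [global_main, global_main, (h i).1, (h (i - 1)).1, (h (i + 1)).1, (h i).2.1, (h (i - 1)).2.2]
  · change nextCtr _ _ = nextCtr _ _
    rw [nextCtr, nextCtr, (h (i - 1)).1, (h (i - 1)).2.2]

lemma Twin.iterate (h : Twin y z) (t : ℕ) :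
    Twin ((CellState.global M s₀ s₁ s₂ a)^[t] y) ((CellState.global M s₀ s₁ s₂ a)^[t] z) := by
  induction t with
  | zero => exact h
  | succ t ih =>
    rw [Function.iterate_succ_apply', Function.iterate_succ_apply']
    exact ih.global

/-- An eraser with nothing but quiet cells on its right passes to the next cell on its left, with
its payload: either directly, or, if there is a wall, at the end of a computation. -/
lemma exists_erase_left {i K : ℤ} (h : Twin y z) (he : (y i).main = .erase)
    (hp : (y i).pay ≠ (z i).pay) (hq : Quiet y i) (hK : ∀ j, K < j → (y j).mark = false)
    (hhalt : ∀ x, ∃ n, FoldedCfg.step M (FoldedCfg.run M (input s₀ s₁ s₂ a x) n) = none) :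
    ∃ t, ((global M s₀ s₁ s₂ a)^[t] y (i - 1)).main = .erase ∧
      ((global M s₀ s₁ s₂ a)^[t] y (i - 1)).pay ≠ ((global M s₀ s₁ s₂ a)^[t] z (i - 1)).pay ∧
      Quiet ((global M s₀ s₁ s₂ a)^[t] y) (i - 1) := by
  set y' := global M s₀ s₁ s₂ a y with hy'
  set z' := global M s₀ s₁ s₂ a z with hz'
  have hez : (z i).main = .erase := by rw [← (h i).1]; exact he
  have hp' : (y' (i - 1)).pay ≠ (z' (i - 1)).pay := by
    change nextPay _ _ ≠ nextPay _ _
    rw [sub_add_cancel, nextPay, nextPay, he, hez]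
    exact hp
  have hq' : Quiet y' (i - 1) := by
    intro j hj
    by_cases hji : j = i
    · subst hji
      have hr := (hq (j + 1) (by omega)).1
      rw [hy', global_main, he]
      generalize (y (j + 1)).main = r at hr
      cases r <;> simp_all [Main.next, Main.blank]
    · exact hq.global j (by omega)
  by_cases hw : ∃ b, (y (i - 1)).main = .wall b
  · obtain ⟨b, hb⟩ := hw
    have hl : (y' (i - 1)).main = .wall true := by
      rw [hy', global_main, hb, sub_add_cancel, he]
      rfl
    obtain ⟨x, hx⟩ := exists_marksAt (a := a) (y := y') (i - 1) (K := K) hK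
    obtain ⟨t, ht⟩ := exists_erase_of_halts hl hq' hx (hhalt x)
    refine ⟨t + 1, ht, ?_, (hq'.iterate t).1⟩
    rw [Function.iterate_succ_apply, Function.iterate_succ_apply, ← hy', ← hz', (hq'.iterate t).2,
      ((h.global.quiet hq').iterate t).2]
    exact hp'
  · push Not at hw
    refine ⟨1, ?_, hp', hq'⟩
    change (y' (i - 1)).main = _
    rw [hy', global_main, sub_add_cancel, he]
    exact Main.next_of_right_erase hw

/-- The word of `u` on the cells `i ≤ n`, followed by an eraser with payload `b` and blank cells. -/
def eraserConfig (u : ℤ → CellState Γ Q) (n : ℕ) (b : Bool) (i : ℤ) : CellState Γ Q :=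
  if i ≤ n then u i else if i = n + 1 then ⟨.erase, false, b, 0⟩ else ⟨.blank, false, false, 0⟩

/-- If the machine halts on `a` and every `x`, then an eraser passes through every word. -/
lemma exists_iterate_ne (u : ℤ → CellState Γ Q) (n : ℕ)
    (hhalt : ∀ x, ∃ n, FoldedCfg.step M (FoldedCfg.run M (input s₀ s₁ s₂ a x) n) = none) :
    ∃ t, (global M s₀ s₁ s₂ a)^[t] (eraserConfig u n true) 0 ≠
      (global M s₀ s₁ s₂ a)^[t] (eraserConfig u n false) 0 := by
  have htw : Twin (eraserConfig u n true) (eraserConfig u n false) := by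
    intro i
    unfold eraserConfig
    split_ifs <;> simp
  have hmark : ∀ j : ℤ, n < j → (eraserConfig u n true j).mark = false := by
    intro j hj
    unfold eraserConfig
    rw [if_neg (by omega)]
    split_ifs <;> rfl
  have key : ∀ d : ℕ, ∃ t,
      ((global M s₀ s₁ s₂ a)^[t] (eraserConfig u n true) (n + 1 - d)).main = .erase ∧
      ((global M s₀ s₁ s₂ a)^[t] (eraserConfig u n true) (n + 1 - d)).pay ≠
        ((global M s₀ s₁ s₂ a)^[t] (eraserConfig u n false) (n + 1 - d)).pay ∧
      Quiet ((global M s₀ s₁ s₂ a)^[t] (eraserConfig u n true)) (n + 1 - d) := by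
    intro d
    induction d with
    | zero =>
      refine ⟨0, ?_, ?_, fun j hj => ?_⟩
      · simp [eraserConfig]
      · simp [eraserConfig]
      · simp only [Function.iterate_zero_apply, eraserConfig]
        rw [if_neg (by omega), if_neg (by omega)]
        simp [Main.blank]
    | succ d ih =>
      obtain ⟨t, h1, h2, h3⟩ := ih
      obtain ⟨t', ht'⟩ := exists_erase_left (htw.iterate t) h1 h2 h3 (K := n)
        (fun j hj => by rw [iterate_mark]; exact hmark j hj) hhalt
      refine ⟨t' + t, ?_⟩
      rw [Function.iterate_add_apply, Function.iterate_add_apply,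
        show (n + 1 - (d + 1 : ℕ) : ℤ) = n + 1 - d - 1 by push_cast; ring]
      exact ht'
  obtain ⟨t, -, h, -⟩ := key (n + 1)
  refine ⟨t, fun he => h ?_⟩
  rw [show (n + 1 - (n + 1 : ℕ) : ℤ) = 0 by push_cast; ring, he]

end CellState

/-! ### The code of the automaton -/

instance {Γ Q : Type} [Finite Γ] [Finite Q] : Finite (Main Γ Q) := by
  let f : Bool ⊕ Bool ⊕ Front ⊕ ((Bool → Γ) × Option (Q × Bool)) → Main Γ Q := fun v =>
    match v with
    | .inl b => .wall b
    | .inr (.inl b) => if b then .erase else .kill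
    | .inr (.inr (.inl g)) => .front g
    | .inr (.inr (.inr p)) => .cell p.1 p.2
  refine Finite.of_surjective f fun m => ?_
  cases m with
  | wall b => exact ⟨.inl b, rfl⟩
  | erase => exact ⟨.inr (.inl true), rfl⟩
  | kill => exact ⟨.inr (.inl false), rfl⟩
  | front g => exact ⟨.inr (.inr (.inl g)), rfl⟩
  | cell t h => exact ⟨.inr (.inr (.inr (t, h))), rfl⟩

namespace CellState

variable {Γ Q : Type} {N : ℕ}

/-- The number of a cell state, for a numbering `e` of its finite components. -/
def enc (e : Main Γ Q × Bool × Bool ≃ Fin (N + 1)) (c : CellState Γ Q) : ℕ :=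
  e (c.main, c.mark, c.pay) + (N + 1) * c.ctr

/-- The cell state with a given number. -/
def dec (e : Main Γ Q × Bool × Bool ≃ Fin (N + 1)) (v : ℕ) : CellState Γ Q :=
  let t := e.symm (Fin.ofNat (N + 1) v)
  ⟨t.1, t.2.1, t.2.2, v / (N + 1)⟩

variable (e : Main Γ Q × Bool × Bool ≃ Fin (N + 1))

lemma dec_enc (c : CellState Γ Q) : dec e (enc e c) = c := by
  have h1 : Fin.ofNat (N + 1) (enc e c) = e (c.main, c.mark, c.pay) := by
    ext
    simp [enc, Nat.mod_eq_of_lt (Fin.is_lt _)]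
  have h2 : enc e c / (N + 1) = c.ctr := by
    rw [enc, Nat.add_mul_div_left _ _ (Nat.succ_pos N), Nat.div_eq_of_lt (Fin.is_lt _), zero_add]
  simp only [dec]
  rw [h1, h2, Equiv.symm_apply_apply]

lemma enc_dec (v : ℕ) : enc e (dec e v) = v := by
  simp [enc, dec, Nat.mod_add_div]

/-- The number of states of the automaton with parameter `a`, diminished by one: the counters of its
cells are at most `a`. -/
def maxState (N a : ℕ) : ℕ := N * (a + 1) + a

lemma maxState_succ (N a : ℕ) : maxState N a + 1 = (N + 1) * (a + 1) := by
  rw [maxState]; ring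

lemma enc_lt {c : CellState Γ Q} {a : ℕ} (h : c.ctr ≤ a) : enc e c < maxState N a + 1 := by
  rw [maxState_succ, enc]
  have := (e (c.main, c.mark, c.pay)).is_lt
  calc (e (c.main, c.mark, c.pay) : ℕ) + (N + 1) * c.ctr < (N + 1) + (N + 1) * c.ctr := by omega
    _ = (N + 1) * (c.ctr + 1) := by ring
    _ ≤ (N + 1) * (a + 1) := Nat.mul_le_mul_left _ (by omega)

lemma dec_ctr_le {v a : ℕ} (h : v < maxState N a + 1) : (dec e v).ctr ≤ a := by
  rw [maxState_succ, mul_comm] at h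
  exact Nat.le_of_lt_succ (Nat.div_lt_of_lt_mul (by rwa [mul_comm] at h))

lemma nextCtr_le {a : ℕ} {l : CellState Γ Q} (h : l.ctr ≤ a) : nextCtr a l ≤ a := by
  unfold nextCtr
  split <;> omega

lemma digits_lt {b l s r : ℕ} (hl : l < b) (hs : s < b) (hr : r < b) :
    l + b * (s + b * r) < b * b * b := by
  have h : s + b * r < b * b := by nlinarith
  nlinarith

section rule

variable [Inhabited Γ] [Inhabited Q] (M : TM0.Machine Γ Q) (s₀ s₁ s₂ : Γ)

/-- An entry of the table of the local rule, whose index has the base `b` digits `l`, `s`, `r`. -/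
def entry (b a i : ℕ) : ℕ :=
  enc e (rule M s₀ s₁ s₂ a (dec e (i % b)) (dec e (i / b % b)) (dec e (i / b / b % b)))

/-- The code of the automaton with parameter `a`. -/
def code (a : ℕ) : CellularAutomaton.Code :=
  (maxState N a, [-1, 0, 1],
    (List.range ((maxState N a + 1) * (maxState N a + 1) * (maxState N a + 1))).map
      (entry e M s₀ s₁ s₂ (maxState N a + 1) a))

lemma entry_eq {b a l s r : ℕ} (hl : l < b) (hs : s < b) (hr : r < b) :
    entry e M s₀ s₁ s₂ b a (l + b * (s + b * r)) =
      enc e (rule M s₀ s₁ s₂ a (dec e l) (dec e s) (dec e r)) := by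
  have hb : 0 < b := by omega
  have h1 : (l + b * (s + b * r)) % b = l := by
    rw [Nat.add_mul_mod_self_left, Nat.mod_eq_of_lt hl]
  have h2 : (l + b * (s + b * r)) / b = s + b * r := by
    rw [Nat.add_mul_div_left _ _ hb, Nat.div_eq_of_lt hl, zero_add]
  have h3 : (s + b * r) % b = s := by
    rw [Nat.add_mul_mod_self_left, Nat.mod_eq_of_lt hs]
  have h4 : (s + b * r) / b = r := by
    rw [Nat.add_mul_div_left _ _ hb, Nat.div_eq_of_lt hs, zero_add]
  rw [entry, h1, h2, h3, h4, Nat.mod_eq_of_lt hr]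

/-- The global map of the coded automaton is the global map on cell states. -/
lemma dec_globalMap (a : ℕ) (X : ℤ → Fin (maxState N a + 1)) (i : ℤ) :
    dec e ((CellularAutomaton.ofCode (code e M s₀ s₁ s₂ a)).globalMap X i :
      Fin (maxState N a + 1)) =
      global M s₀ s₁ s₂ a (fun j => dec e (X j)) i := by
  have h1 : ((CellularAutomaton.ofCode (code e M s₀ s₁ s₂ a)).globalMap X i :
      Fin (maxState N a + 1)) = Fin.ofNat (maxState N a + 1) ((code e M s₀ s₁ s₂ a).2.2.getD
        ((X (i - 1) : ℕ) + (maxState N a + 1) * (X i + (maxState N a + 1) * X (i + 1))) 0) := by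
    simp [CellularAutomaton.ofCode, CellularAutomaton.globalMap, code, Nat.ofDigits_cons,
      List.attach, List.attachWith, sub_eq_add_neg]
  have hb : (X (i - 1) : ℕ) + (maxState N a + 1) * (X i + (maxState N a + 1) * X (i + 1)) <
      (maxState N a + 1) * (maxState N a + 1) * (maxState N a + 1) := by
    exact digits_lt (X (i - 1)).is_lt (X i).is_lt (X (i + 1)).is_lt
  rw [h1]
  have h2 : (code e M s₀ s₁ s₂ a).2.2.getD
      ((X (i - 1) : ℕ) + (maxState N a + 1) * (X i + (maxState N a + 1) * X (i + 1))) 0 =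
      enc e (global M s₀ s₁ s₂ a (fun j => dec e (X j)) i) := by
    have h3 := entry_eq e M s₀ s₁ s₂ (a := a) (X (i - 1)).is_lt (X i).is_lt (X (i + 1)).is_lt
    change _ = enc e (rule M s₀ s₁ s₂ a (dec e (X (i - 1))) (dec e (X i)) (dec e (X (i + 1))))
    rw [← h3, code, List.getD_eq_getElem?_getD, List.getElem?_map, List.getElem?_range hb]
    rfl
  rw [h2]
  have h3 : enc e (global M s₀ s₁ s₂ a (fun j => dec e (X j)) i) < maxState N a + 1 :=
    enc_lt e (nextCtr_le (dec_ctr_le e (X (i - 1)).is_lt))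
  rw [Fin.val_ofNat, Nat.mod_eq_of_lt h3, dec_enc]

lemma dec_iterate (a : ℕ) (X : ℤ → Fin (maxState N a + 1)) (t : ℕ) (i : ℤ) :
    dec e ((CellularAutomaton.ofCode (code e M s₀ s₁ s₂ a)).globalMap^[t] X i :
      Fin (maxState N a + 1)) = (global M s₀ s₁ s₂ a)^[t] (fun j => dec e (X j)) i := by
  induction t generalizing X with
  | zero => rfl
  | succ t ih =>
    rw [Function.iterate_succ_apply (global M s₀ s₁ s₂ a)]
    refine (ih _).trans ?_
    exact congrArg (fun Y => (global M s₀ s₁ s₂ a)^[t] Y i)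
      (funext fun j => dec_globalMap e M s₀ s₁ s₂ a X j)

/-- The automaton with parameter `a` is sensitive if and only if the machine halts on `a` and every
`x`. -/
theorem sensitive_code_iff (a : ℕ) :
    (CellularAutomaton.ofCode (code e M s₀ s₁ s₂ a)).Sensitive ↔
      ∀ x, ∃ n, FoldedCfg.step M (FoldedCfg.run M (input s₀ s₁ s₂ a x) n) = none := by
  rw [CellularAutomaton.sensitive_iff_noBlockingWord _ 1
    (by simp [CellularAutomaton.ofCode, code])]
  let toFin : CellState Γ Q → Fin (maxState N a + 1) := fun c => Fin.ofNat _ (enc e c)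
  have hdec : ∀ c : CellState Γ Q, c.ctr ≤ a → dec e (toFin c) = c := by
    intro c hc
    simp only [toFin]
    rw [Fin.val_ofNat, Nat.mod_eq_of_lt (enc_lt e hc), dec_enc]
  constructor
  · intro hA x
    by_contra! hrun
    obtain ⟨X, Y, hX, hY, t, i, hi, hne⟩ := hA (a + x + 7) fun i => toFin (wallConfig Γ Q a x i)
    refine hne (Fin.ext ?_)
    have hw : ∀ i, (wallConfig Γ Q a x i).ctr ≤ a := by
      intro i
      unfold wallConfig
      split_ifs <;> simp
    have key : ∀ Z : ℤ → Fin (maxState N a + 1),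
        (∀ i : ℤ, i.natAbs ≤ a + x + 7 → Z i = toFin (wallConfig Γ Q a x i)) →
        ((CellularAutomaton.ofCode (code e M s₀ s₁ s₂ a)).globalMap^[t] Z i :
          Fin (maxState N a + 1)).val = enc e (⟨.wall false, false, false, 0⟩ : CellState Γ Q) := by
      intro Z hZ
      have := dec_iterate e M s₀ s₁ s₂ a Z t i
      rw [iterate_eq_wall (y := fun j => dec e (Z j)) hrun
        (fun j hj => by rw [hZ j hj, hdec _ (hw j)]) t hi] at this
      rw [← this, enc_dec]
    exact (key X hX).trans (key Y hY).symm
  · intro hhalt n u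
    let X : Bool → ℤ → Fin (maxState N a + 1) := fun b i =>
      if i ≤ n then u i else toFin (eraserConfig (fun j => dec e (u j)) n b i)
    have hX : ∀ b, (fun j => dec e (X b j)) = eraserConfig (fun j => dec e (u j)) n b := by
      intro b
      funext j
      by_cases hj : j ≤ n
      · simp [X, hj, eraserConfig]
      · simp only [X, hj]
        refine hdec _ ?_
        unfold eraserConfig
        rw [if_neg hj]
        split_ifs <;> simp
    obtain ⟨t, ht⟩ := exists_iterate_ne (fun j => dec e (u j)) n hhalt
    refine ⟨X true, X false, fun i hi => if_pos (by omega), fun i hi => if_pos (by omega), t, 0,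
      by simp, fun he => ht ?_⟩
    have h1 := dec_iterate e M s₀ s₁ s₂ a (X true) t 0
    have h2 := dec_iterate e M s₀ s₁ s₂ a (X false) t 0
    rw [hX] at h1 h2
    rw [← h1, ← h2, he]

end rule

end CellState

/-! ### Hardness -/

namespace CellState

variable {Γ Q : Type} {N : ℕ} (e : Main Γ Q × Bool × Bool ≃ Fin (N + 1))

/-- Whether the counter is set to the parameter by a cell with the given number. -/
def setsCtr (l : Fin (N + 1)) : Bool :=
  match (dec e l : CellState Γ Q).main with
  | .front .second => true
  | _ => false

/-- Whether the counter is decreased by a cell with the given number. -/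
def decreasesCtr (l : Fin (N + 1)) : Bool :=
  match (dec e l : CellState Γ Q).main with
  | .front .mid => true
  | _ => false

lemma dec_mod (v : ℕ) : (dec e (Fin.ofNat (N + 1) v : Fin (N + 1)) : CellState Γ Q).main =
    (dec e v : CellState Γ Q).main ∧
    (dec e (Fin.ofNat (N + 1) v : Fin (N + 1)) : CellState Γ Q).mark =
      (dec e v : CellState Γ Q).mark ∧
    (dec e (Fin.ofNat (N + 1) v : Fin (N + 1)) : CellState Γ Q).pay =
      (dec e v : CellState Γ Q).pay := by
  have : Fin.ofNat (N + 1) ((Fin.ofNat (N + 1) v : Fin (N + 1)) : ℕ) = Fin.ofNat (N + 1) v := by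
    ext; simp
  simp only [dec]
  rw [this]
  exact ⟨rfl, rfl, rfl⟩

lemma getI_input {Γ : Type} [Inhabited Γ] (s₀ s₁ s₂ : Γ) (a x i : ℕ) :
    (s₀ :: s₁ :: (List.replicate (a + 1) s₂ ++ s₁ :: List.replicate x s₂)).getI i =
      input s₀ s₁ s₂ a x i := by
  rcases i with _ | _ | i
  · simp [input, Front.stage, Front.sym]
  · simp [input, Front.stage, Front.sym]
  rw [List.getI_eq_getElem?_getD]
  simp only [List.getElem?_cons_succ, List.getElem?_append, List.length_replicate,
    List.getElem?_replicate, input, Front.stage]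
  rcases Nat.lt_trichotomy i (a + 1) with h | h | h
  · simp [h, show i ≤ a by omega, Front.sym]
  · simp [h, Front.sym]
  · obtain ⟨k, rfl⟩ : ∃ k, i = a + 1 + (k + 1) := ⟨i - (a + 2), by omega⟩
    simp only [show ¬ a + 1 + (k + 1) < a + 1 by omega, if_false, Nat.add_sub_cancel_left,
      List.getElem?_cons_succ, List.getElem?_replicate]
    by_cases hk : k < x
    · simp [hk, show a + 1 + (k + 1) + 1 + 1 < a + 4 + x by omega, Front.sym]
      grind
    · simp [hk, show ¬ a + 1 + (k + 1) + 1 + 1 < a + 4 + x by omega, Front.sym]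
      grind

variable [Inhabited Γ] [Inhabited Q] (M : TM0.Machine Γ Q) (s₀ s₁ s₂ : Γ)

/-- The finite part of the local rule, in terms of the numbers of the finite components. -/
def finiteRule (p : Bool × Fin (N + 1) × Fin (N + 1) × Fin (N + 1)) : Fin (N + 1) :=
  let l : CellState Γ Q := dec e p.2.1
  let s : CellState Γ Q := dec e p.2.2.1
  let r : CellState Γ Q := dec e p.2.2.2
  e (Main.next M s₀ s₁ s₂ p.1 s.mark l.main s.main r.main, s.mark, nextPay s r)

lemma enc_rule (a l s r : ℕ) :
    enc e (rule M s₀ s₁ s₂ a (dec e l) (dec e s) (dec e r)) =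
      (finiteRule e M s₀ s₁ s₂ (decide (l / (N + 1) = 0), Fin.ofNat (N + 1) l, Fin.ofNat (N + 1) s,
        Fin.ofNat (N + 1) r) : ℕ) +
      (N + 1) * (if setsCtr e (Fin.ofNat (N + 1) l) = true then a
        else if decreasesCtr e (Fin.ofNat (N + 1) l) = true then l / (N + 1) - 1 else 0) := by
  have hl := dec_mod e l
  have hs := dec_mod e s
  have hr := dec_mod e r
  have hpay : nextPay (dec e (Fin.ofNat (N + 1) s : Fin (N + 1)) : CellState Γ Q)
      (dec e (Fin.ofNat (N + 1) r : Fin (N + 1))) = nextPay (dec e s) (dec e r) := by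
    rw [nextPay, nextPay, hr.1, hr.2.2, hs.2.2]
  have hctr : nextCtr a (dec e l : CellState Γ Q) =
      if setsCtr e (Fin.ofNat (N + 1) l) = true then a
        else if decreasesCtr e (Fin.ofNat (N + 1) l) = true then l / (N + 1) - 1 else 0 := by
    rw [nextCtr, setsCtr, decreasesCtr, hl.1]
    have : (dec e l : CellState Γ Q).ctr = l / (N + 1) := rfl
    rw [this]
    generalize (dec e l : CellState Γ Q).main = m
    cases m with
    | front f => cases f <;> simp
    | _ => simp
  simp only [enc, rule, finiteRule, hpay, hctr, hl.1, hs.1, hs.2.1, hr.1]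
  rfl

lemma primrec_enc_rule : Primrec fun p : ℕ × ℕ × ℕ × ℕ =>
    enc e (rule M s₀ s₁ s₂ p.1 (dec e p.2.1) (dec e p.2.2.1) (dec e p.2.2.2)) := by
  have ha : Primrec fun p : ℕ × ℕ × ℕ × ℕ => p.1 := Primrec.fst
  have hl : Primrec fun p : ℕ × ℕ × ℕ × ℕ => p.2.1 := Primrec.fst.comp Primrec.snd
  have hs : Primrec fun p : ℕ × ℕ × ℕ × ℕ => p.2.2.1 :=
    Primrec.fst.comp (Primrec.snd.comp Primrec.snd)
  have hr : Primrec fun p : ℕ × ℕ × ℕ × ℕ => p.2.2.2 :=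
    Primrec.snd.comp (Primrec.snd.comp Primrec.snd)
  have hfin : Primrec fun v : ℕ => Fin.ofNat (N + 1) v :=
    Primrec.fin_val_iff.1 ((Primrec.nat_mod.comp Primrec.id (Primrec.const (N + 1))).of_eq
      fun v => by simp)
  have hdiv : Primrec fun p : ℕ × ℕ × ℕ × ℕ => p.2.1 / (N + 1) :=
    Primrec.nat_div.comp hl (Primrec.const _)
  have hzero : Primrec fun p : ℕ × ℕ × ℕ × ℕ => decide (p.2.1 / (N + 1) = 0) :=
    (Primrec.eq.comp hdiv (Primrec.const 0)).decide
  have hrule := Primrec.fin_val.comp ((Primrec.dom_finite (finiteRule e M s₀ s₁ s₂)).comp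
    (hzero.pair ((hfin.comp hl).pair ((hfin.comp hs).pair (hfin.comp hr)))))
  have hset : PrimrecPred fun p : ℕ × ℕ × ℕ × ℕ => setsCtr e (Fin.ofNat (N + 1) p.2.1) = true :=
    Primrec.eq.comp ((Primrec.dom_finite (setsCtr e)).comp (hfin.comp hl)) (Primrec.const true)
  have hdecr : PrimrecPred fun p : ℕ × ℕ × ℕ × ℕ =>
      decreasesCtr e (Fin.ofNat (N + 1) p.2.1) = true :=
    Primrec.eq.comp ((Primrec.dom_finite (decreasesCtr e)).comp (hfin.comp hl)) (Primrec.const true)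
  have hctr := Primrec.ite hset ha (Primrec.ite hdecr (Primrec.pred.comp hdiv) (Primrec.const 0))
  refine (Primrec.nat_add.comp hrule (Primrec.nat_mul.comp (Primrec.const (N + 1)) hctr)).of_eq
    fun p => ?_
  exact (enc_rule e M s₀ s₁ s₂ p.1 p.2.1 p.2.2.1 p.2.2.2).symm

lemma primrec_code : Primrec (code e M s₀ s₁ s₂) := by
  have hmax : Primrec (maxState N) :=
    Primrec.nat_add.comp (Primrec.nat_mul.comp (Primrec.const N) Primrec.succ) Primrec.id
  have hb : Primrec fun a => maxState N a + 1 := Primrec.succ.comp hmax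
  have hentry : Primrec₂ fun a i => entry e M s₀ s₁ s₂ (maxState N a + 1) a i := by
    have hb' : Primrec fun p : ℕ × ℕ => maxState N p.1 + 1 := hb.comp Primrec.fst
    have h1 := Primrec.nat_div.comp Primrec.snd hb'
    have h2 := Primrec.nat_div.comp h1 hb'
    exact (primrec_enc_rule e M s₀ s₁ s₂).comp (Primrec.fst.pair
      ((Primrec.nat_mod.comp Primrec.snd hb').pair
        ((Primrec.nat_mod.comp h1 hb').pair (Primrec.nat_mod.comp h2 hb'))))
  exact hmax.pair ((Primrec.const _).pair (Primrec.list_map (Primrec.list_range.comp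
    (Primrec.nat_mul.comp (Primrec.nat_mul.comp hb hb) hb)) hentry))

end CellState

theorem manyOneReducible_sensitive {q : ℕ → Prop} (hq : IsPi02 q) :
    ManyOneReducible q
      (fun c : CellularAutomaton.Code => (CellularAutomaton.ofCode c).Sensitive) := by
  obtain ⟨R, hR, hq⟩ := hq
  obtain ⟨Γ, Q, _, _, _, _, M, s₀, s₁, s₂, hM⟩ := exists_finite_machine hR
  obtain ⟨n, ⟨e⟩⟩ := Finite.exists_equiv_fin (Main Γ Q × Bool × Bool)
  obtain ⟨N, rfl⟩ : ∃ N, n = N + 1 := by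
    refine Nat.exists_eq_succ_of_ne_zero ?_
    rintro rfl
    exact (e (.erase, true, true)).elim0
  refine ⟨CellState.code e M s₀ s₁ s₂, (CellState.primrec_code e M s₀ s₁ s₂).to_comp, fun a => ?_⟩
  refine (hq a).trans (Iff.trans (forall_congr' fun x => ?_)
    (CellState.sensitive_code_iff e M s₀ s₁ s₂ a).symm)
  rw [← hM, FoldedCfg.exists_step_run_eq_none_iff M _ _ (CellState.getI_input s₀ s₁ s₂ a x)]

/-! ### Membership in `Π⁰₂` -/

/-- Quantifiers over denumerable types may replace those over `ℕ` in the definition of `Π⁰₂`. -/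
lemma PrimrecPred.isPi02_forall_exists {α β γ : Type} [Primcodable α] [Denumerable β]
    [Denumerable γ] {S : α × β × γ → Prop} (hS : PrimrecPred S) :
    IsPi02 fun a => ∀ b, ∃ c, S (a, b, c) := by
  refine ⟨fun p => S (p.1, Denumerable.ofNat β p.2.1, Denumerable.ofNat γ p.2.2), ?_, fun a => ?_⟩
  · exact (hS.comp (Primrec.fst.pair
      (((Primrec.ofNat β).comp (Primrec.fst.comp Primrec.snd)).pair
        ((Primrec.ofNat γ).comp (Primrec.snd.comp Primrec.snd))))).computablePred
  · constructor
    · intro h x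
      obtain ⟨c, hc⟩ := h (Denumerable.ofNat β x)
      exact ⟨Encodable.encode c, by simpa only [Denumerable.ofNat_encode] using hc⟩
    · intro h b
      obtain ⟨y, hy⟩ := h (Encodable.encode b)
      rw [Denumerable.ofNat_encode] at hy
      exact ⟨_, hy⟩

namespace CellularAutomaton

open Encodable

namespace Code

/-- A bound for the neighbourhood of a coded automaton. -/
def radius (c : Code) : ℕ := c.2.1.foldr (fun z r => z.natAbs + r) 0

/-- The next state of the cell that has the index `j + c.radius` in the list `w` of the states of
adjacent cells. -/
def nextState (c : Code) (w : List ℕ) (j : ℕ) : ℕ :=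
  c.2.2.getD (c.2.1.foldr
    (fun z v => w.getD (((j + c.radius : ℕ) : ℤ) + z).toNat 0 + (c.1 + 1) * v) 0) 0 % (c.1 + 1)

/-- One step of a coded automaton on a list of states of adjacent cells; the result is shorter by
the radius on both sides. -/
def evolve (c : Code) (w : List ℕ) : List ℕ :=
  (List.range (w.length - 2 * c.radius)).map (nextState c w)

lemma natAbs_le_radius (c : Code) {z : ℤ} (hz : z ∈ c.2.1) : z.natAbs ≤ c.radius := by
  have h : ∀ l : List ℤ, z ∈ l → z.natAbs ≤ l.foldr (fun z r => z.natAbs + r) 0 := by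
    intro l hl
    induction l with
    | nil => simp at hl
    | cons z' l ih =>
      rw [List.foldr_cons]
      rcases List.mem_cons.1 hl with rfl | h
      · omega
      · exact (ih h).trans (by omega)
  exact h _ hz

/-- The list of the states of the `len` cells from `lo` on. -/
def word {k : ℕ} (X : ℤ → Fin k) (lo : ℤ) (len : ℕ) : List ℕ :=
  (List.range len).map fun j : ℕ => (X (lo + (j : ℤ)) : ℕ)

lemma word_getD {k : ℕ} (X : ℤ → Fin k) (lo : ℤ) {len j : ℕ} (h : j < len) :
    (word X lo len).getD j 0 = X (lo + j) := by
  simp [word, h]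

lemma word_length {k : ℕ} (X : ℤ → Fin k) (lo : ℤ) (len : ℕ) : (word X lo len).length = len := by
  simp [word]

lemma word_eq_map {k : ℕ} (w : List ℕ) {X : ℤ → Fin (k + 1)} {lo : ℤ}
    (hX : ∀ i, (X i : ℕ) = w.getD (i - lo).toNat 0 % (k + 1)) :
    word X lo w.length = w.map (· % (k + 1)) := by
  refine List.ext_getElem (by simp [word]) fun j h1 h2 => ?_
  have hj : j < w.length := by simpa using h2
  simp [word, hX, hj]

lemma evolve_word (c : Code) (X : ℤ → Fin (c.1 + 1)) (lo : ℤ) (len : ℕ) :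
    evolve c (word X lo len) =
      word ((ofCode c).globalMap X) (lo + c.radius) (len - 2 * c.radius) := by
  rw [evolve, word_length]
  refine List.map_congr_left fun (j : ℕ) hj => ?_
  rw [List.mem_range] at hj
  have hdig : ∀ f : ℤ → ℕ, ∀ l : List ℤ, Nat.ofDigits (c.1 + 1) (l.map f) =
      l.foldr (fun z v => f z + (c.1 + 1) * v) 0 := by
    intro f l
    induction l with
    | nil => rfl
    | cons z l ih => simp [Nat.ofDigits_cons, ih]
  simp only [globalMap, ofCode, Fin.val_ofNat, nextState]
  rw [List.attach_map_val (l := c.2.1) (f := fun z => (X (lo + c.radius + j + z) : ℕ)), hdig]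
  congr 2
  refine List.foldr_ext _ _ _ fun z hz v => ?_
  have := natAbs_le_radius c hz
  rw [word_getD _ _ (by omega), Int.toNat_of_nonneg (by omega)]
  congr 3
  omega

lemma evolve_iterate_word (c : Code) (X : ℤ → Fin (c.1 + 1)) (lo : ℤ) (len t : ℕ) :
    (evolve c)^[t] (word X lo len) =
      word ((ofCode c).globalMap^[t] X) (lo + t * c.radius) (len - 2 * (t * c.radius)) := by
  induction t with
  | zero => simp
  | succ t ih =>
    rw [Function.iterate_succ_apply', ih, evolve_word, Function.iterate_succ_apply']
    congr 1
    · rw [Nat.cast_succ, add_one_mul, add_assoc]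
    · rw [Nat.add_mul]; omega

/-- Two extensions `w₁`, `w₂` of the word `u` on the cells `-n, …, n` by `m` cells on each side
evolve differently: after `t` steps they differ in the cell `j - c.radius`. -/
def Separates (c : Code) (n : ℕ) (u : List ℕ) (m t j : ℕ) (w₁ w₂ : List ℕ) : Prop :=
  w₁.length = 2 * (n + m) + 1 ∧ w₂.length = 2 * (n + m) + 1 ∧ j ≤ 2 * c.radius ∧
  t * c.radius + c.radius ≤ n + m ∧
  (∀ i ∈ List.range (2 * n + 1), w₁.getD (m + i) 0 % (c.1 + 1) = u.getD i 0 % (c.1 + 1) ∧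
    w₂.getD (m + i) 0 % (c.1 + 1) = u.getD i 0 % (c.1 + 1)) ∧
  ((evolve c)^[t] (w₁.map (· % (c.1 + 1)))).getD (n + m - (t * c.radius + c.radius) + j) 0 ≠
    ((evolve c)^[t] (w₂.map (· % (c.1 + 1)))).getD (n + m - (t * c.radius + c.radius) + j) 0

lemma evolve_iterate_getD (c : Code) (X : ℤ → Fin (c.1 + 1)) {N t j : ℕ} (hj : j ≤ 2 * c.radius)
    (ht : t * c.radius + c.radius ≤ N) :
    ((evolve c)^[t] (word X (-N) (2 * N + 1))).getD (N - (t * c.radius + c.radius) + j) 0 =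
      (ofCode c).globalMap^[t] X (j - c.radius) := by
  have h : -(N : ℤ) + t * c.radius + (N - (t * c.radius + c.radius) + j : ℕ) = j - c.radius := by
    push_cast [Nat.cast_sub ht]
    ring
  rw [evolve_iterate_word, word_getD _ _ (by omega), h]

theorem sensitive_iff_separates (c : Code) : (ofCode c).Sensitive ↔
    ∀ (n : ℕ) (u : List ℕ), ∃ m t j w₁ w₂, Separates c n u m t j w₁ w₂ := by
  rw [sensitive_iff_noBlockingWord (ofCode c) c.radius
    fun z hz => natAbs_le_radius c (List.mem_toFinset.1 hz)]
  constructor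
  · intro h n u
    obtain ⟨X, Y, hX, hY, t, i, hi, hne⟩ :=
      h n fun i => Fin.ofNat (c.1 + 1) (u.getD (i + n).toNat 0)
    refine ⟨t * c.radius + c.radius, t, (i + c.radius).toNat,
      word X (-(n + (t * c.radius + c.radius) : ℕ)) (2 * (n + (t * c.radius + c.radius)) + 1),
      word Y (-(n + (t * c.radius + c.radius) : ℕ)) (2 * (n + (t * c.radius + c.radius)) + 1),
      word_length _ _ _, word_length _ _ _, by omega, by omega, ?_, ?_⟩
    · intro i hi
      rw [List.mem_range] at hi
      rw [word_getD _ _ (by omega), word_getD _ _ (by omega),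
        show (-(n + (t * c.radius + c.radius) : ℕ) : ℤ) + (t * c.radius + c.radius + i : ℕ) =
          i - n by push_cast; ring, hX _ (by omega), hY _ (by omega)]
      simp
    · have hmod : ∀ Z : ℤ → Fin (c.1 + 1), ∀ lo len,
          (word Z lo len).map (· % (c.1 + 1)) = word Z lo len := by
        intro Z lo len
        simp only [word, List.map_map]
        refine List.map_congr_left fun j _ => ?_
        exact Nat.mod_eq_of_lt (Fin.is_lt _)
      rw [hmod, hmod, evolve_iterate_getD c X (by omega) (by omega),
        evolve_iterate_getD c Y (by omega) (by omega),
        show (((i + c.radius).toNat : ℕ) : ℤ) - c.radius = i by omega]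
      exact fun he => hne (Fin.ext he)
  · intro h n u
    obtain ⟨m, t, j, w₁, w₂, h1, h2, hj, ht, hu, hne⟩ := h n (word u (-n) (2 * n + 1))
    let X : List ℕ → ℤ → Fin (c.1 + 1) := fun w i =>
      Fin.ofNat (c.1 + 1) (w.getD (i - (-(n + m : ℕ))).toNat 0)
    have hX : ∀ w : List ℕ, w.length = 2 * (n + m) + 1 → w.map (· % (c.1 + 1)) =
        word (X w) (-(n + m : ℕ)) (2 * (n + m) + 1) := by
      intro w hw
      rw [← hw]
      exact (word_eq_map w fun i => by simp [X]).symm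
    have hag : ∀ w : List ℕ, (∀ i ∈ List.range (2 * n + 1), w.getD (m + i) 0 % (c.1 + 1) =
        (word u (-n) (2 * n + 1)).getD i 0 % (c.1 + 1)) →
        ∀ i : ℤ, i.natAbs ≤ n → X w i = u i := by
      intro w hw i hi
      have := hw (i + n).toNat (List.mem_range.2 (by omega))
      rw [word_getD _ _ (by omega), show (-n : ℤ) + ((i + n).toNat : ℕ) = i by omega,
        Nat.mod_eq_of_lt (u i).is_lt] at this
      refine Fin.ext ?_
      rw [← this]
      simp only [X, Fin.val_ofNat]
      congr 2
      omega
    refine ⟨X w₁, X w₂, hag w₁ fun i hi => (hu i hi).1, hag w₂ fun i hi => (hu i hi).2, t,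
      j - c.radius, by omega, fun he => hne ?_⟩
    rw [hX w₁ h1, hX w₂ h2, evolve_iterate_getD c _ hj ht, evolve_iterate_getD c _ hj ht, he]

section Primrec

lemma encode_int (z : ℤ) : encode z = match z with
    | .ofNat n => 2 * n
    | .negSucc n => 2 * n + 1 := by cases z <;> rfl

lemma primrec_natAbs : Primrec Int.natAbs := by
  refine (Primrec.nat_div.comp (Primrec.succ.comp Primrec.encode) (Primrec.const 2)).of_eq
    fun z => ?_
  rw [encode_int]
  cases z <;> simp <;> omega

lemma primrec_add_toNat : Primrec₂ fun (m : ℕ) (z : ℤ) => ((m : ℤ) + z).toNat := by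
  have he : Primrec fun p : ℕ × ℤ => encode p.2 := Primrec.encode.comp Primrec.snd
  have hd : Primrec fun p : ℕ × ℤ => encode p.2 / 2 := Primrec.nat_div.comp he (Primrec.const 2)
  refine (Primrec.ite (Primrec.eq.comp (Primrec.nat_mod.comp he (Primrec.const 2))
    (Primrec.const 0)) (Primrec.nat_add.comp Primrec.fst hd)
    (Primrec.nat_sub.comp Primrec.fst (Primrec.succ.comp hd))).of_eq fun p => ?_
  obtain ⟨m, z⟩ := p
  simp only [encode_int]
  cases z <;> simp <;> omega

lemma primrec_radius : Primrec radius := by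
  have hh : Primrec₂ fun (_ : Code) (p : ℤ × ℕ) => p.1.natAbs + p.2 :=
    Primrec.nat_add.comp (primrec_natAbs.comp (Primrec.fst.comp Primrec.snd))
      (Primrec.snd.comp Primrec.snd)
  exact Primrec.list_foldr (Primrec.fst.comp Primrec.snd) (Primrec.const 0) hh

lemma primrec_nextState : Primrec fun p : (Code × List ℕ) × ℕ => nextState p.1.1 p.1.2 p.2 := by
  have hc : Primrec fun p : (Code × List ℕ) × ℕ => p.1.1 := Primrec.fst.comp Primrec.fst
  have hk : Primrec fun p : (Code × List ℕ) × ℕ => p.1.1.1 + 1 :=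
    Primrec.succ.comp (Primrec.fst.comp hc)
  have hr : Primrec fun p : (Code × List ℕ) × ℕ => p.2 + p.1.1.radius :=
    Primrec.nat_add.comp Primrec.snd (primrec_radius.comp hc)
  have hw : Primrec fun p : (Code × List ℕ) × ℕ => p.1.2 := Primrec.snd.comp Primrec.fst
  have hi : Primrec fun q : ((Code × List ℕ) × ℕ) × ℤ × ℕ =>
      (((q.1.2 + q.1.1.1.radius : ℕ) : ℤ) + q.2.1).toNat :=
    primrec_add_toNat.comp (hr.comp Primrec.fst) (Primrec.fst.comp Primrec.snd)
  have hl : Primrec fun q : ((Code × List ℕ) × ℕ) × ℤ × ℕ =>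
      q.1.1.2.getD (((q.1.2 + q.1.1.1.radius : ℕ) : ℤ) + q.2.1).toNat 0 :=
    (Primrec.list_getD 0).comp (hw.comp Primrec.fst) hi
  have hm : Primrec fun q : ((Code × List ℕ) × ℕ) × ℤ × ℕ => (q.1.1.1.1 + 1) * q.2.2 :=
    Primrec.nat_mul.comp (hk.comp Primrec.fst) (Primrec.snd.comp Primrec.snd)
  have hg : Primrec₂ fun (p : (Code × List ℕ) × ℕ) (q : ℤ × ℕ) =>
      p.1.2.getD (((p.2 + p.1.1.radius : ℕ) : ℤ) + q.1).toNat 0 + (p.1.1.1 + 1) * q.2 :=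
    Primrec.nat_add.comp hl hm
  have hf : Primrec fun p : (Code × List ℕ) × ℕ => p.1.1.2.1 :=
    Primrec.fst.comp (Primrec.snd.comp hc)
  have ht : Primrec fun p : (Code × List ℕ) × ℕ => p.1.1.2.2 :=
    Primrec.snd.comp (Primrec.snd.comp hc)
  have hd := Primrec.list_foldr hf (Primrec.const 0) hg
  exact Primrec.nat_mod.comp ((Primrec.list_getD 0).comp ht hd) hk

lemma primrec_evolve : Primrec₂ evolve := by
  have hn : Primrec₂ fun (p : Code × List ℕ) (j : ℕ) => nextState p.1 p.2 j := primrec_nextState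
  have hr : Primrec fun p : Code × List ℕ => List.range (p.2.length - 2 * p.1.radius) :=
    Primrec.list_range.comp (Primrec.nat_sub.comp (Primrec.list_length.comp Primrec.snd)
      (Primrec.nat_mul.comp (Primrec.const 2) (primrec_radius.comp Primrec.fst)))
  exact Primrec.list_map hr hn

/-- The test underlying `sensitive_iff_separates`, with all data packed into one tuple. -/
lemma primrecPred_separates : PrimrecPred
    fun p : Code × (ℕ × List ℕ) × ℕ × ℕ × ℕ × List ℕ × List ℕ =>
      Separates p.1 p.2.1.1 p.2.1.2 p.2.2.1 p.2.2.2.1 p.2.2.2.2.1 p.2.2.2.2.2.1 p.2.2.2.2.2.2 := by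
  let T := Code × (ℕ × List ℕ) × ℕ × ℕ × ℕ × List ℕ × List ℕ
  have hc : Primrec fun p : T => p.1 := Primrec.fst
  have hnu : Primrec fun p : T => p.2.1 := Primrec.fst.comp Primrec.snd
  have hy : Primrec fun p : T => p.2.2 := Primrec.snd.comp Primrec.snd
  have hy' : Primrec fun p : T => p.2.2.2.2 := Primrec.snd.comp (Primrec.snd.comp hy)
  have hn : Primrec fun p : T => p.2.1.1 := Primrec.fst.comp hnu
  have hu : Primrec fun p : T => p.2.1.2 := Primrec.snd.comp hnu
  have hm : Primrec fun p : T => p.2.2.1 := Primrec.fst.comp hy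
  have ht : Primrec fun p : T => p.2.2.2.1 := Primrec.fst.comp (Primrec.snd.comp hy)
  have hj : Primrec fun p : T => p.2.2.2.2.1 := Primrec.fst.comp hy'
  have hw₁ : Primrec fun p : T => p.2.2.2.2.2.1 := Primrec.fst.comp (Primrec.snd.comp hy')
  have hw₂ : Primrec fun p : T => p.2.2.2.2.2.2 := Primrec.snd.comp (Primrec.snd.comp hy')
  have hk : Primrec fun p : T => p.1.1 + 1 := Primrec.succ.comp (Primrec.fst.comp hc)
  have hr : Primrec fun p : T => p.1.radius := primrec_radius.comp hc
  have hN : Primrec fun p : T => p.2.1.1 + p.2.2.1 := Primrec.nat_add.comp hn hm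
  have hs : Primrec fun p : T => p.2.2.2.1 * p.1.radius + p.1.radius :=
    Primrec.nat_add.comp (Primrec.nat_mul.comp ht hr) hr
  have hlen : Primrec fun p : T => 2 * (p.2.1.1 + p.2.2.1) + 1 :=
    Primrec.succ.comp (Primrec.nat_mul.comp (Primrec.const 2) hN)
  have hag : ∀ {w : T → List ℕ}, Primrec w → PrimrecRel fun (i : ℕ) (p : T) =>
      (w p).getD (p.2.2.1 + i) 0 % (p.1.1 + 1) = p.2.1.2.getD i 0 % (p.1.1 + 1) := by
    intro w hw
    have hk' := hk.comp (Primrec.snd (α := ℕ))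
    have hi := Primrec.nat_add.comp (hm.comp (Primrec.snd (α := ℕ))) Primrec.fst
    exact Primrec.eq.comp (Primrec.nat_mod.comp ((Primrec.list_getD 0).comp
      (hw.comp Primrec.snd) hi) hk') (Primrec.nat_mod.comp ((Primrec.list_getD 0).comp
      (hu.comp Primrec.snd) Primrec.fst) hk')
  have hrange : Primrec fun p : T => List.range (2 * p.2.1.1 + 1) := Primrec.list_range.comp
    (Primrec.succ.comp (Primrec.nat_mul.comp (Primrec.const 2) hn))
  have hev : ∀ {w : T → List ℕ}, Primrec w → Primrec fun p : T =>
      ((evolve p.1)^[p.2.2.2.1] ((w p).map (· % (p.1.1 + 1)))).getD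
        (p.2.1.1 + p.2.2.1 - (p.2.2.2.1 * p.1.radius + p.1.radius) + p.2.2.2.2.1) 0 := by
    intro w hw
    have hmod : Primrec₂ fun (p : T) (a : ℕ) => a % (p.1.1 + 1) :=
      Primrec.nat_mod.comp Primrec.snd (hk.comp Primrec.fst)
    have hstep : Primrec₂ fun (p : T) (v : List ℕ) => evolve p.1 v :=
      primrec_evolve.comp (hc.comp Primrec.fst) Primrec.snd
    exact (Primrec.list_getD 0).comp (Primrec.nat_iterate ht (Primrec.list_map hw hmod) hstep)
      (Primrec.nat_add.comp (Primrec.nat_sub.comp hN hs) hj)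
  have hagree : PrimrecRel fun (i : ℕ) (p : T) =>
      p.2.2.2.2.2.1.getD (p.2.2.1 + i) 0 % (p.1.1 + 1) = p.2.1.2.getD i 0 % (p.1.1 + 1) ∧
      p.2.2.2.2.2.2.getD (p.2.2.1 + i) 0 % (p.1.1 + 1) = p.2.1.2.getD i 0 % (p.1.1 + 1) :=
    PrimrecPred.and (hag hw₁) (hag hw₂)
  have hall := hagree.forall_mem_list.comp hrange Primrec.id
  exact (Primrec.eq.comp (Primrec.list_length.comp hw₁) hlen).and
    ((Primrec.eq.comp (Primrec.list_length.comp hw₂) hlen).and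
    ((Primrec.nat_le.comp hj (Primrec.nat_mul.comp (Primrec.const 2) hr)).and
    ((Primrec.nat_le.comp hs hN).and
    (hall.and (Primrec.eq.comp (hev hw₁) (hev hw₂)).not))))

end Primrec

theorem isPi02_sensitive : IsPi02 fun c : Code => (ofCode c).Sensitive := by
  have h : (fun c : Code => (ofCode c).Sensitive) = fun c : Code => ∀ b : ℕ × List ℕ,
      ∃ d : ℕ × ℕ × ℕ × List ℕ × List ℕ,
        Separates c b.1 b.2 d.1 d.2.1 d.2.2.1 d.2.2.2.1 d.2.2.2.2 := by
    funext c
    simp only [sensitive_iff_separates, Prod.forall, Prod.exists]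
  rw [h]
  exact primrecPred_separates.isPi02_forall_exists

end Code

end CellularAutomaton

theorem theorem1 :
    Pi02Complete (fun c : CellularAutomaton.Code => (CellularAutomaton.ofCode c).Sensitive) :=
  ⟨CellularAutomaton.Code.isPi02_sensitive, fun _ hq => manyOneReducible_sensitive hq⟩
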